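/- Let $(W,S)$ be a Coxeter system with $W$ finite, let $\mathfrak l$ be its length function and let $\Bbbk$ be a field. Let $\mathcal H(W)$ be the $0$-Hecke monoid of $(W,S)$, i.e. the monoid generated by idempotents $e_t$, $t\in S$, subject to the braid relations of $W$, and for $w\in W$ with reduced decomposition $w=t_1t_2\cdots t_k$ put $z_w:=e_{t_1}e_{t_2}\cdots e_{t_k}$. For $J\subseteq S$ let $W_J$ be the subgroup of $W$ generated by $J$, let $w_J$ be its longest element and put $e_J:=z_{w_J}$; let $w_0=w_S$ be the longest element of $W$ and $e_0:=z_{w_0}$. For $s\in S$ write $(s):=S\setminus\{s\}$. For $J\subseteq S$ let $\theta_J$ be the one-dimensional representation of $\mathcal H(W)$ over $\Bbbk$ with $\theta_J(e_t)=\mathrm{id}$ for $t\in J$ and $\theta_J(e_t)=0$ for $t\in S\setminus J$; it satisfies $\theta_J(z_w)=\mathrm{id}$ if $w\in W_J$ and $\theta_J(z_w)=0$ if $w\notin W_J$. Theorem. For every $s\in S$, the left ideal $P'_{(s)}:=\Bbbk\mathcal H(W)\,(e_{(s)}-e_0)$ of the monoid algebra $\Bbbk\mathcal H(W)$ is a projective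 indecomposable left module, and its socle (the sum of its simple submodules) is simple. This socle is the one-dimensional subspace $\Bbbk\,(z_{w_0s}-e_0)$ of $\Bbbk\mathcal H(W)$, and as a $\Bbbk\mathcal H(W)$-module it is isomorphic to $\theta_{(w_0sw_0)}$ (recall that $w_0Sw_0=S$). -/

import Mathlib

/-- The defining relations of the `0`-Hecke monoid of a Coxeter matrix `M`: the generators are
idempotent and satisfy the braid relations `e_i e_j e_i ⋯ = e_j e_i e_j ⋯` (`M i j` factors on
both sides; when `M i j = 0`, i.e. the order is infinite, this is the trivial relation `1 = 1`). -/
inductive CoxeterMatrix.ZeroHeckeRel {B : Type*} (M : CoxeterMatrix B) :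
    FreeMonoid B → FreeMonoid B → Prop
  | idem (i : B) :
      ZeroHeckeRel M (FreeMonoid.of i * FreeMonoid.of i) (FreeMonoid.of i)
  | braid (i j : B) :
      ZeroHeckeRel M (FreeMonoid.ofList (CoxeterSystem.alternatingWord i j (M i j)))
        (FreeMonoid.ofList (CoxeterSystem.alternatingWord j i (M i j)))

/-- The `0`-Hecke monoid of a Coxeter matrix, by generators and relations. -/
abbrev CoxeterMatrix.ZeroHecke {B : Type*} (M : CoxeterMatrix B) : Type _ :=
  PresentedMonoid M.ZeroHeckeRel

/-- The generator `e_i` of the `0`-Hecke monoid. -/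
def CoxeterMatrix.heckeGen {B : Type*} (M : CoxeterMatrix B) (i : B) : M.ZeroHecke :=
  PresentedMonoid.of M.ZeroHeckeRel i

namespace CoxeterSystem

variable {B W : Type*} [Group W] {M : CoxeterMatrix B} (cs : CoxeterSystem M W)

/-- The element `z_w = e_{i_1} ⋯ e_{i_k}` of the `0`-Hecke monoid, for a chosen reduced
decomposition `w = s_{i_1} ⋯ s_{i_k}` (by Matsumoto's theorem the choice does not matter). -/
noncomputable def heckeElt (w : W) : M.ZeroHecke :=
  ((cs.exists_isReduced w).choose.map M.heckeGen).prod

/-- The parabolic subgroup `W_J`. -/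
def parabolic (J : Set B) : Subgroup W := Subgroup.closure (cs.simple '' J)

theorem exists_longest [Finite W] (J : Set B) :
    ∃ w ∈ cs.parabolic J, ∀ v ∈ cs.parabolic J, cs.length v ≤ cs.length w :=
  Set.exists_max_image (cs.parabolic J : Set W) cs.length (Set.toFinite _) ⟨1, one_mem _⟩

/-- The longest element `w_J` of the parabolic subgroup `W_J` of a finite Coxeter group. -/
noncomputable def longestOf [Finite W] (J : Set B) : W := (cs.exists_longest J).choose

/-- The longest element `w_0` of a finite Coxeter group. -/
noncomputable def longest [Finite W] : W := cs.longestOf Set.univ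

/-- The idempotent `e_J = z_{w_J}` of the `0`-Hecke monoid. -/
noncomputable def heckeIdem [Finite W] (J : Set B) : M.ZeroHecke := cs.heckeElt (cs.longestOf J)

/-- The idempotent `e_0 = z_{w_0}`, the zero element of the `0`-Hecke monoid. -/
noncomputable def heckeZero [Finite W] : M.ZeroHecke := cs.heckeElt cs.longest

/-- The set `(r) = S \ {r}` of all simple reflections different from `r`, as a set of indices. -/
def maximalSubset (r : W) : Set B := {t | cs.simple t ≠ r}

/-- The left ideal `P'_{(s)} = k H(W) (e_{(s)} - e_0)` of the monoid algebra `k H(W)`. -/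
noncomputable def projIndec [Finite W] (k : Type*) [Field k] (s : B) :
    Submodule (MonoidAlgebra k M.ZeroHecke) (MonoidAlgebra k M.ZeroHecke) :=
  Submodule.span (MonoidAlgebra k M.ZeroHecke)
    {MonoidAlgebra.of k M.ZeroHecke (cs.heckeIdem (cs.maximalSubset (cs.simple s)))
      - MonoidAlgebra.of k M.ZeroHecke cs.heckeZero}

end CoxeterSystem

open Classical in
theorem CoxeterMatrix.character_rel {B : Type*} (M : CoxeterMatrix B) (k : Type*) [Field k]
    (J : Set B) (x y : FreeMonoid B) (h : M.ZeroHeckeRel x y) :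
    FreeMonoid.lift (fun i => if i ∈ J then (1 : k) else 0) x
      = FreeMonoid.lift (fun i => if i ∈ J then (1 : k) else 0) y := by
  have key : ∀ l : List B, (l.map (fun i => if i ∈ J then (1 : k) else 0)).prod
      = if ∀ i ∈ l, i ∈ J then 1 else 0 := by
    intro l
    induction l with
    | nil => simp
    | cons a l ih => by_cases ha : a ∈ J <;> simp [ih, ha]
  cases h with
  | idem i => by_cases hi : i ∈ J <;> simp [hi]
  | braid i j =>
    rw [FreeMonoid.lift_ofList, FreeMonoid.lift_ofList, key, key]
    have hm : ∀ a b c : B, ∀ m : ℕ, 2 ≤ m →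
        (c ∈ CoxeterSystem.alternatingWord a b m ↔ c = a ∨ c = b) := by
      intro a b c m hm
      induction m, hm using Nat.le_induction generalizing a b with
      | base => simp [CoxeterSystem.alternatingWord]
      | succ n _ ih =>
        rw [CoxeterSystem.alternatingWord_succ]
        simp only [List.concat_eq_append, List.mem_append, ih, List.mem_singleton]
        tauto
    by_cases hij : i = j
    · subst hij; rfl
    · have h1 : M i j ≠ 1 := M.off_diagonal i j hij
      rcases Nat.eq_zero_or_pos (M i j) with h0 | h0
      · simp [h0, CoxeterSystem.alternatingWord]
      · simp only [hm i j _ _ (by omega : 2 ≤ M i j), hm j i _ _ (by omega : 2 ≤ M i j),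
          or_comm]

open Classical in
/-- The character `H(W) → k` with `e_t ↦ 1` for `t ∈ J` and `e_t ↦ 0` for `t ∉ J`. -/
noncomputable def CoxeterMatrix.character {B : Type*} (M : CoxeterMatrix B)
    (k : Type*) [Field k] (J : Set B) : M.ZeroHecke →* k :=
  PresentedMonoid.lift (fun i => if i ∈ J then (1 : k) else 0) (M.character_rel k J)

/-- The one-dimensional representation `θ_J` of the `0`-Hecke monoid on `k`. -/
noncomputable def CoxeterMatrix.theta {B : Type*} (M : CoxeterMatrix B)
    (k : Type*) [Field k] (J : Set B) : Representation k M.ZeroHecke k :=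
  (algebraMap k (Module.End k k)).toMonoidHom.comp (M.character k J)

/-- The socle of a module: the sum of its simple submodules. -/
def moduleSocle (A V : Type*) [Ring A] [AddCommGroup V] [Module A V] : Submodule A V :=
  sSup {N | IsSimpleModule A N}

/-- A module is indecomposable if it is nonzero and not the direct sum of two nonzero
submodules. -/
def ModuleIndecomposable (A V : Type*) [Ring A] [AddCommGroup V] [Module A V] : Prop :=
  Nontrivial V ∧ ∀ N N' : Submodule A V, IsCompl N N' → N = ⊥ ∨ N' = ⊥

/-! Let λ be the linear form on the monoid algebra taking the coefficient of `e_0`. Two properties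
of λ carry the proof. It is nondegenerate: for x ≠ 0 some λ(h x) is nonzero
(`exists_coeff_heckeZero_ne_zero`). It is a trace up to conjugation by `w_0`: λ(e_i x) = λ(x e_j)
when s_j = w_0 s_i w_0 (`coeff_heckeGen_mul`).

Every nonzero left ideal contains a nonzero x on which each generator acts as 0 or 1, and
nondegeneracy gives λ(x) ≠ 0. If x lies in `P'_{(s)}`, then x e_j = x for j ≠ s, so the trace
property gives λ(e_i x) = λ(x) ≠ 0, hence e_i x = x, for every s_i other than w_0 s w_0. The
remaining generator kills x: otherwise e_0 x = x, while `e_0` annihilates `P'_{(s)}`. The vector v =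
z_{w_0 s} - e_0 lies in `P'_{(s)}`, has the same character and λ(v) = -1. The combination x + λ(x) v
is again a joint eigenvector, but λ vanishes on it, so it is 0. Thus v belongs to every nonzero
submodule (`socleGenerator_mem`), which gives the socle and indecomposability; projectivity holds
because e_{(s)} - e_0 is idempotent.

To read off coefficients, the z_w must be a basis. They exhaust the monoid by Matsumoto's theorem
and are distinct because the monoid acts on W by Demazure products. Both facts rest on the exchange
condition, obtained from parities of inversion sequences, and on s_i s_j having order exactly `M i
j`, obtained from the geometric representation. -/

/-! ### The geometric representation and the order of s_i s_j -/

/-- The simple coroot of the geometric representation of a Coxeter matrix. -/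
noncomputable def CoxeterMatrix.coroot {B : Type*} (M : CoxeterMatrix B) (i : B) :
    Module.Dual ℝ (B →₀ ℝ) :=
  Finsupp.linearCombination ℝ (fun j => -(2 * Real.cos (Real.pi / M i j)))

theorem CoxeterMatrix.coroot_single {B : Type*} (M : CoxeterMatrix B) (i j : B) :
    M.coroot i (Finsupp.single j 1) = -(2 * Real.cos (Real.pi / M i j)) := by
  simp [CoxeterMatrix.coroot]

theorem CoxeterMatrix.coroot_single_self {B : Type*} (M : CoxeterMatrix B) (i : B) :
    M.coroot i (Finsupp.single i 1) = 2 := by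
  simp [CoxeterMatrix.coroot_single]

/-- The simple reflection of the geometric representation of a Coxeter matrix. -/
noncomputable def CoxeterMatrix.geomReflection {B : Type*} (M : CoxeterMatrix B) (i : B) :
    (B →₀ ℝ) ≃ₗ[ℝ] (B →₀ ℝ) :=
  Module.reflection (M.coroot_single_self i)

theorem Chebyshev.eval_S_add_eval_S_mul_cos (θ : ℝ) (n : ℤ) :
    ((Polynomial.Chebyshev.S ℝ n).eval (2 * Real.cos (2 * θ))
      + (Polynomial.Chebyshev.S ℝ (n - 1)).eval (2 * Real.cos (2 * θ))) * Real.sin (2 * θ)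
      = 2 * Real.sin ((2 * n + 1) * θ) * Real.cos θ := by
  rw [add_mul, Polynomial.Chebyshev.S_two_mul_real_cos, Polynomial.Chebyshev.S_two_mul_real_cos]
  have h1 : ((n : ℝ) + 1) * (2 * θ) = (2 * n + 1) * θ + θ := by ring
  have h2 : (((n - 1 : ℤ) : ℝ) + 1) * (2 * θ) = (2 * n + 1) * θ - θ := by push_cast; ring
  rw [h1, h2, Real.sin_add, Real.sin_sub]
  ring

theorem CoxeterMatrix.three_le {B : Type*} (M : CoxeterMatrix B) {i j : B} (hij : i ≠ j)
    (h0 : M i j ≠ 0) (h2 : M i j ≠ 2) : 3 ≤ M i j := by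
  have := M.off_diagonal i j hij
  omega

theorem CoxeterMatrix.sin_two_mul_pi_div_pos {m : ℕ} (hm : 3 ≤ m) :
    0 < Real.sin (2 * (Real.pi / m)) := by
  have hm' : (3 : ℝ) ≤ m := by exact_mod_cast hm
  have hpi := Real.pi_pos
  apply Real.sin_pos_of_pos_of_lt_pi
  · positivity
  · rw [← mul_div_assoc, div_lt_iff₀ (by linarith)]
    nlinarith

/-- With m = `M i j` and θ = π/m, powers of a product of two reflections have Chebyshev coefficients
at 2 cos 2θ. For m = 2k the factor S_{k-1} vanishes, for m = 2k+1 the factor S_k + S_{k-1}; in both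
cases because sin(mθ) = sin π = 0. -/
theorem CoxeterMatrix.geomReflection_isLiftable {B : Type*} (M : CoxeterMatrix B) :
    M.IsLiftable M.geomReflection := by
  intro i j
  by_cases hij : i = j
  · subst hij
    rw [M.diagonal, pow_one]
    ext1 v
    exact Module.involutive_reflection (M.coroot_single_self i) v
  by_cases h0 : M i j = 0
  · rw [h0, pow_zero]
  apply LinearEquiv.toLinearMap_injective
  have hs : M j i = M i j := M.symmetric j i
  set θ := Real.pi / M i j with hθ
  have ht : 2 * Real.cos (2 * θ) = M.coroot i (Finsupp.single j 1) *
      M.coroot j (Finsupp.single i 1) - 2 := by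
    rw [M.coroot_single, M.coroot_single, hs, Real.cos_two_mul]
    ring
  have key := Module.reflection_mul_reflection_pow (M.coroot_single_self i)
    (M.coroot_single_self j) (M i j) _ ht
  refine key.trans ?_
  -- Here 2θ = π, so sin 2θ = 0 could not be cancelled below.
  by_cases h2 : M i j = 2
  · have hc : Real.cos θ = 0 := by rw [hθ, h2]; exact Real.cos_pi_div_two
    have hc2 : 2 * Real.cos (2 * θ) = -2 := by rw [Real.cos_two_mul, hc]; norm_num
    rw [M.coroot_single, M.coroot_single, hs, ← hθ, hc, hc2, h2]
    ext v w
    simp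
    ring
  have hm := M.three_le hij h0 h2
  have hsin := CoxeterMatrix.sin_two_mul_pi_div_pos hm
  rw [← hθ] at hsin
  have hmR : (M i j : ℝ) ≠ 0 := by exact_mod_cast h0
  have hmθ : (M i j : ℝ) * θ = Real.pi := by rw [hθ]; field_simp
  obtain ⟨k, hk | hk⟩ := Nat.even_or_odd' (M i j)
  · have hS : (Polynomial.Chebyshev.S ℝ ((k : ℤ) - 1)).eval (2 * Real.cos (2 * θ)) = 0 := by
      have := Polynomial.Chebyshev.S_two_mul_real_cos (2 * θ) ((k : ℤ) - 1)
      have h3 : (((k : ℤ) - 1 : ℤ) + 1 : ℝ) * (2 * θ) = Real.pi := by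
        rw [← hmθ, hk]; push_cast; ring
      rw [h3, Real.sin_pi] at this
      exact (mul_eq_zero.mp this).resolve_right hsin.ne'
    have e1 : ((M i j : ℤ) - 2) / 2 = (k : ℤ) - 1 := by omega
    have e2 : ((M i j : ℤ) - 1) / 2 = (k : ℤ) - 1 := by omega
    rw [e1, e2, hS]
    simp
  · have hS := Chebyshev.eval_S_add_eval_S_mul_cos θ k
    have h3 : (2 * ((k : ℤ) : ℝ) + 1) * θ = Real.pi := by
      rw [← hmθ, hk]; push_cast; ring
    rw [h3, Real.sin_pi, mul_zero, zero_mul] at hS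
    have hS := (mul_eq_zero.mp hS).resolve_right hsin.ne'
    have e1 : ((M i j : ℤ) - 1) / 2 = (k : ℤ) := by omega
    have e2 : ((M i j : ℤ) - 3) / 2 = (k : ℤ) - 1 := by omega
    have e3 : ((M i j : ℤ)) / 2 = (k : ℤ) := by omega
    have e4 : ((M i j : ℤ) - 2) / 2 = (k : ℤ) - 1 := by omega
    rw [e1, e2, e3, e4, hS]
    simp

namespace CoxeterSystem

variable {B W : Type*} [Group W] {M : CoxeterMatrix B} (cs : CoxeterSystem M W)

/-- The geometric representation of a Coxeter group. -/
noncomputable def geomRep : W →* ((B →₀ ℝ) ≃ₗ[ℝ] (B →₀ ℝ)) :=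
  cs.lift ⟨M.geomReflection, M.geomReflection_isLiftable⟩

/-- The n-th power fixes the simple root α_i; comparing coordinates at i and j gives, in the generic
case, S_{n-1} = 0 and S_n = 1 at 2 cos 2θ, whence cos(2nθ) = 1. -/
theorem dvd_of_simple_mul_simple_pow_eq_one {i j : B} (hij : i ≠ j) (n : ℕ)
    (h : (cs.simple i * cs.simple j) ^ n = 1) : M i j ∣ n := by
  have h1 := congrArg cs.geomRep h
  rw [map_pow, map_mul, geomRep, lift_apply_simple, lift_apply_simple, map_one] at h1
  have h1 := congrArg (fun g : (B →₀ ℝ) ≃ₗ[ℝ] (B →₀ ℝ) => g (Finsupp.single i 1)) h1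
  have hs : M j i = M i j := M.symmetric j i
  set θ := Real.pi / M i j with hθ
  have ht : 2 * Real.cos (2 * θ) = M.coroot i (Finsupp.single j 1) *
      M.coroot j (Finsupp.single i 1) - 2 := by
    rw [M.coroot_single, M.coroot_single, hs, Real.cos_two_mul]
    ring
  have key := Module.reflection_mul_reflection_pow_apply_self (M.coroot_single_self i)
    (M.coroot_single_self j) n _ ht
  have h2 := key.symm.trans h1
  have hg : M.coroot j (Finsupp.single i 1) = -(2 * Real.cos θ) := by
    rw [M.coroot_single, hs]
  rw [hg] at h2
  have hi := DFunLike.congr_fun h2 i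
  have hj := DFunLike.congr_fun h2 j
  simp [hij, Ne.symm hij] at hi hj
  -- Infinite order: division by zero makes θ = 0, and S_{n-1}(2) = n forces n = 0.
  by_cases h0 : M i j = 0
  · have hc : Real.cos θ = 1 := by rw [hθ, h0]; simp
    have hc2 : 2 * Real.cos (2 * θ) = 2 := by rw [Real.cos_two_mul, hc]; norm_num
    rw [hc2, hc, Polynomial.Chebyshev.S_eval_two] at hj
    simp at hj
    simp [hj]
  by_cases h2 : M i j = 2
  · have hc : Real.cos θ = 0 := by rw [hθ, h2]; exact Real.cos_pi_div_two
    have hc2 : 2 * Real.cos (2 * θ) = -2 := by rw [Real.cos_two_mul, hc]; norm_num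
    rw [hc2, Polynomial.Chebyshev.S_eval_neg_two, Polynomial.Chebyshev.S_eval_neg_two] at hi
    rw [h2]
    by_contra hodd
    have hodd : Odd n := by rwa [← Nat.not_even_iff_odd, even_iff_two_dvd]
    have ho : Odd (n : ℤ) := by exact_mod_cast hodd
    have he : Even ((n : ℤ) - 1) := by
      obtain ⟨r, hr⟩ := ho
      exact ⟨r, by omega⟩
    rw [Int.negOnePow_odd _ ho, Int.negOnePow_even _ he] at hi
    push_cast at hi
    linarith
  have hm := M.three_le hij h0 h2
  have hsin := CoxeterMatrix.sin_two_mul_pi_div_pos hm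
  rw [← hθ] at hsin
  have hmR : (M i j : ℝ) ≠ 0 := by exact_mod_cast h0
  have hpi := Real.pi_pos
  have hcos : Real.cos θ ≠ 0 := by
    intro hc
    rw [Real.sin_two_mul, hc] at hsin
    simp at hsin
  have hS : (Polynomial.Chebyshev.S ℝ ((n : ℤ) - 1)).eval (2 * Real.cos (2 * θ)) = 0 := by
    tauto
  have hS2 := Polynomial.Chebyshev.S_two_mul_real_cos (2 * θ) ((n : ℤ) - 1)
  have hS3 := Polynomial.Chebyshev.S_two_mul_real_cos (2 * θ) (n : ℤ)
  have e1 : (((n : ℤ) - 1 : ℤ) + 1 : ℝ) * (2 * θ) = n * (2 * θ) := by push_cast; ring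
  have e2 : (((n : ℤ) : ℝ) + 1) * (2 * θ) = n * (2 * θ) + 2 * θ := by push_cast; ring
  rw [hS, e1, zero_mul] at hS2
  rw [hS, add_zero] at hi
  rw [hi, e2, Real.sin_add, ← hS2, one_mul, zero_mul, zero_add] at hS3
  have hc1 : Real.cos (n * (2 * θ)) = 1 := by
    have := mul_right_cancel₀ hsin.ne' ((one_mul _).trans hS3)
    exact this.symm
  obtain ⟨q, hq⟩ := (Real.cos_eq_one_iff _).mp hc1
  have : (n : ℝ) = q * M i j := by
    rw [hθ] at hq
    field_simp at hq
    linarith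
  have : (n : ℤ) = q * M i j := by exact_mod_cast this
  exact_mod_cast (Dvd.intro_left q this.symm : (M i j : ℤ) ∣ n)

end CoxeterSystem

/-! ### Inversion parity and the exchange condition -/

namespace CoxeterSystem

variable {B W : Type*} [Group W] {M : CoxeterMatrix B} (cs : CoxeterSystem M W)

open Classical in
/-- The action of a simple reflection on pairs `(t, ε)`, recording by `ε` the parity of the number
of times that `t` is hit. -/
noncomputable def inversionStep (i : B) : Function.End (W × ZMod 2) :=
  fun p => (cs.simple i * p.1 * cs.simple i, p.2 + if p.1 = cs.simple i then 1 else 0)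

open Classical in
theorem inversionStep_word_apply (ω : List B) (t : W) (ε : ZMod 2) :
    (ω.map cs.inversionStep).prod (t, ε)
      = (cs.wordProd ω * t * (cs.wordProd ω)⁻¹, ε + ((cs.rightInvSeq ω).count t : ℕ)) := by
  induction ω generalizing t ε with
  | nil => simp [Function.End.one_def]
  | cons i ω ih =>
    rw [List.map_cons, List.prod_cons]
    change cs.inversionStep i ((ω.map cs.inversionStep).prod (t, ε)) = _
    rw [ih]
    rw [inversionStep, wordProd_cons, rightInvSeq, List.count_cons]
    have h : cs.wordProd ω * t * (cs.wordProd ω)⁻¹ = cs.simple i ↔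
        (cs.wordProd ω)⁻¹ * cs.simple i * cs.wordProd ω = t := by
      constructor
      · intro h; rw [← h]; group
      · intro h; rw [← h]; group
    simp only [h, beq_iff_eq, Prod.mk.injEq]
    constructor
    · rw [mul_inv_rev, inv_simple]; group
    · split_ifs <;> push_cast <;> ring

theorem inversionStep_prod_reverse_alternatingWord (i j : B) (m : ℕ) :
    ((alternatingWord j i (2 * m)).reverse.map cs.inversionStep).prod
      = (cs.inversionStep i * cs.inversionStep j) ^ m := by
  induction m with
  | zero => simp [alternatingWord]
  | succ m ih =>
    have : 2 * (m + 1) = 2 * m + 1 + 1 := by ring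
    rw [this, alternatingWord_succ, alternatingWord_succ, pow_succ', ← ih]
    simp [mul_assoc]

theorem leftInvSeq_alternatingWord_eq_map (i j : B) (p : ℕ) :
    cs.leftInvSeq (alternatingWord i j (2 * p))
      = (List.range (2 * p)).map (fun k => cs.simple i * (cs.simple j * cs.simple i) ^ k) := by
  apply List.ext_getElem
  · simp
  · intro k h1 h2
    have hk : k < 2 * p := by simpa using h1
    rw [cs.getElem_leftInvSeq_alternatingWord i j p k hk, prod_alternatingWord_eq_mul_pow]
    have : (2 * k + 1) / 2 = k := by omega
    simp [this]

/-- The inversion sequence of the word for (s_i s_j)^m, m = `M i j`, has length 2m and period m.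
Each reflection thus occurs an even number of times and the parity is unchanged. -/
theorem inversionStep_isLiftable : M.IsLiftable cs.inversionStep := by
  classical
  intro i j
  rw [← inversionStep_prod_reverse_alternatingWord]
  funext ⟨t, ε⟩
  rw [inversionStep_word_apply, rightInvSeq_reverse, List.count_reverse,
    leftInvSeq_alternatingWord_eq_map, wordProd_reverse, prod_alternatingWord_eq_mul_pow]
  have hp : (cs.simple i * cs.simple j) ^ M i j = 1 := cs.simple_mul_simple_pow i j
  have hp' : (cs.simple j * cs.simple i) ^ M i j = 1 := cs.simple_mul_simple_pow' i j
  rw [two_mul, List.range_add, List.map_append, List.map_map]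
  have : (fun k => cs.simple j * (cs.simple i * cs.simple j) ^ k) ∘ (fun x => M i j + x)
      = (fun k => cs.simple j * (cs.simple i * cs.simple j) ^ k) := by
    funext k
    simp [pow_add, hp]
  rw [this, List.count_append]
  have h2 : (M i j + M i j) / 2 = M i j := by omega
  simp [h2, hp', Function.End.one_def, CharTwo.add_self_eq_zero]

/-- The action of `W` on pairs `(t, ε)`. -/
noncomputable def inversionAction : W →* Function.End (W × ZMod 2) :=
  cs.lift ⟨cs.inversionStep, cs.inversionStep_isLiftable⟩

/-- The parity of the multiplicity of `t` in the right inversion sequence of any word for `w`. -/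
noncomputable def inversionParity (w t : W) : ZMod 2 := (cs.inversionAction w (t, 0)).2

open Classical in
theorem inversionAction_wordProd (ω : List B) (t : W) (ε : ZMod 2) :
    cs.inversionAction (cs.wordProd ω) (t, ε)
      = (cs.wordProd ω * t * (cs.wordProd ω)⁻¹, ε + ((cs.rightInvSeq ω).count t : ℕ)) := by
  rw [← inversionStep_word_apply, wordProd, map_list_prod, List.map_map]
  have : cs.inversionAction ∘ cs.simple = cs.inversionStep := by
    funext i
    simp [inversionAction]
  rw [this]

open Classical in
theorem inversionParity_wordProd (ω : List B) (t : W) :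
    cs.inversionParity (cs.wordProd ω) t = ((cs.rightInvSeq ω).count t : ℕ) := by
  rw [inversionParity, inversionAction_wordProd, zero_add]

theorem inversionAction_apply (w t : W) (ε : ZMod 2) :
    cs.inversionAction w (t, ε) = (w * t * w⁻¹, ε + cs.inversionParity w t) := by
  classical
  obtain ⟨ω, rfl⟩ := cs.wordProd_surjective w
  rw [inversionAction_wordProd, inversionParity_wordProd]

theorem inversionParity_mul (x y t : W) :
    cs.inversionParity (x * y) t
      = cs.inversionParity y t + cs.inversionParity x (y * t * y⁻¹) := by
  have := cs.inversionAction_apply (x * y) t 0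
  rw [map_mul] at this
  change cs.inversionAction x (cs.inversionAction y (t, 0)) = _ at this
  rw [inversionAction_apply, inversionAction_apply] at this
  have := congrArg Prod.snd this
  simpa using this.symm

theorem inversionParity_one (t : W) : cs.inversionParity 1 t = 0 := by
  classical
  simpa using cs.inversionParity_wordProd [] t

/-- Write t = u s u⁻¹. The contributions of u and u⁻¹ cancel, their sum being the parity for u u⁻¹ =
1; only that of s remains. -/
theorem inversionParity_self {t : W} (ht : cs.IsReflection t) : cs.inversionParity t t = 1 := by
  classical
  obtain ⟨u, i, rfl⟩ := ht
  have h1 := cs.inversionParity_mul u u⁻¹ (u * cs.simple i * u⁻¹)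
  have h2 : cs.inversionParity (cs.simple i) (cs.simple i) = 1 := by
    simpa using cs.inversionParity_wordProd [i] (cs.simple i)
  have e1 : u⁻¹ * (u * cs.simple i * u⁻¹) * u⁻¹⁻¹ = cs.simple i := by group
  rw [e1, mul_inv_cancel, inversionParity_one] at h1
  rw [inversionParity_mul, inversionParity_mul, e1, mul_inv_cancel_right, h2,
    add_left_comm, ← h1, add_zero]

/-- Odd parity puts t in the inversion sequence of a reduced word, so t is an inversion. If the
parity for w is even, the one for w t is odd, so t shortens w t and cannot shorten w. -/
theorem isRightInversion_iff_inversionParity {w t : W} (ht : cs.IsReflection t) :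
    cs.IsRightInversion w t ↔ cs.inversionParity w t = 1 := by
  classical
  have key : ∀ v : W, cs.inversionParity v t = 1 → cs.IsRightInversion v t := by
    intro v hv
    obtain ⟨ω, hω, rfl⟩ := cs.exists_isReduced v
    rw [inversionParity_wordProd] at hv
    apply cs.isRightInversion_of_mem_rightInvSeq hω
    by_contra hmem
    rw [List.count_eq_zero_of_not_mem hmem] at hv
    simp at hv
  refine ⟨fun h => ?_, key w⟩
  by_contra hne
  have h0 : cs.inversionParity w t = 0 := by
    generalize cs.inversionParity w t = x at hne
    revert x; decide
  have h1 : cs.inversionParity (w * t) t = 1 := by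
    rw [inversionParity_mul, cs.inversionParity_self ht, mul_inv_cancel_right, h0, add_zero]
  have h2 := (key _ h1).2
  rw [mul_assoc, ht.mul_self, mul_one] at h2
  exact absurd h.2 (by omega)

theorem mem_rightInvSeq_of_isRightInversion {ω : List B} {t : W}
    (h : cs.IsRightInversion (cs.wordProd ω) t) : t ∈ cs.rightInvSeq ω := by
  classical
  have h1 := (cs.isRightInversion_iff_inversionParity h.1).mp h
  rw [inversionParity_wordProd] at h1
  by_contra hmem
  rw [List.count_eq_zero_of_not_mem hmem] at h1
  simp at h1

/-- The strong exchange condition. -/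
theorem exists_mul_eq_wordProd_eraseIdx {ω : List B} {t : W}
    (h : cs.IsRightInversion (cs.wordProd ω) t) :
    ∃ k < ω.length, cs.wordProd ω * t = cs.wordProd (ω.eraseIdx k) := by
  obtain ⟨k, hk, rfl⟩ := List.mem_iff_getElem.mp (cs.mem_rightInvSeq_of_isRightInversion h)
  refine ⟨k, by simpa using hk, ?_⟩
  rw [← cs.wordProd_mul_getD_rightInvSeq, List.getD_eq_getElem _ 1 hk]

/-- The exchange condition for left descents. -/
theorem exists_simple_mul_eq_wordProd_eraseIdx {ω : List B} {i : B}
    (h : cs.IsLeftDescent (cs.wordProd ω) i) :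
    ∃ k < ω.length, cs.simple i * cs.wordProd ω = cs.wordProd (ω.eraseIdx k) := by
  have e : cs.wordProd ω * ((cs.wordProd ω)⁻¹ * cs.simple i * cs.wordProd ω)
      = cs.simple i * cs.wordProd ω := by group
  rw [← e]
  apply cs.exists_mul_eq_wordProd_eraseIdx
  refine ⟨⟨(cs.wordProd ω)⁻¹, i, by group⟩, ?_⟩
  rw [e]
  exact h

/-- Each entry occurs once, hence with odd parity, hence also in the inversion sequence of a reduced
word for the same element, which is therefore at least as long. -/
theorem isReduced_of_nodup_rightInvSeq {ω : List B} (h : (cs.rightInvSeq ω).Nodup) :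
    cs.IsReduced ω := by
  classical
  obtain ⟨ω', hω', he⟩ := cs.exists_isReduced (cs.wordProd ω)
  have hsub : cs.rightInvSeq ω ⊆ cs.rightInvSeq ω' := by
    intro t ht
    apply cs.mem_rightInvSeq_of_isRightInversion
    rw [← he, isRightInversion_iff_inversionParity _ (cs.isReflection_of_mem_rightInvSeq ω ht),
      inversionParity_wordProd, List.count_eq_one_of_mem h ht]
    simp
  have hlen := (h.subperm hsub).length_le
  rw [length_rightInvSeq, length_rightInvSeq] at hlen
  refine le_antisymm (cs.length_wordProd_le ω) ?_
  rw [he, hω'.eq]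
  exact hlen

theorem isReduced_of_nodup_leftInvSeq {ω : List B} (h : (cs.leftInvSeq ω).Nodup) :
    cs.IsReduced ω := by
  rw [← isReduced_reverse_iff]
  apply cs.isReduced_of_nodup_rightInvSeq
  rw [rightInvSeq_reverse]
  exact List.nodup_reverse.mpr h

theorem isReduced_alternatingWord {i j : B} (hij : i ≠ j) {p : ℕ} (hp : M i j = 0 ∨ p ≤ M i j) :
    cs.IsReduced (alternatingWord i j p) := by
  have key : ∀ a b : B, a ≠ b → (M a b = 0 ∨ p ≤ M a b) →
      cs.IsReduced ((alternatingWord a b (2 * p)).take p) := by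
    intro a b hab hp
    apply cs.isReduced_of_nodup_leftInvSeq
    rw [leftInvSeq_take, leftInvSeq_alternatingWord_eq_map, ← List.map_take, List.take_range,
      min_eq_left (by omega)]
    have key2 : ∀ k l : ℕ, k < l → l < p →
        cs.simple a * (cs.simple b * cs.simple a) ^ k
          ≠ cs.simple a * (cs.simple b * cs.simple a) ^ l := by
      intro k l hkl hl heq
      obtain ⟨d, rfl⟩ := Nat.exists_eq_add_of_le hkl.le
      rw [pow_add, mul_right_inj, left_eq_mul] at heq
      have hdvd := cs.dvd_of_simple_mul_simple_pow_eq_one hab.symm d heq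
      rw [M.symmetric b a] at hdvd
      rcases hp with h0 | hp
      · rw [h0, zero_dvd_iff] at hdvd
        omega
      · have := Nat.le_of_dvd (by omega) hdvd
        omega
    refine List.Nodup.map_on ?_ List.nodup_range
    intro k hk l hl heq
    rw [List.mem_range] at hk hl
    rcases lt_trichotomy k l with h | h | h
    · exact absurd heq (key2 k l h hl)
    · exact h
    · exact absurd heq.symm (key2 l k h hk)
  -- Alternating words are anchored at their last letter, so the prefix of length p swaps the two
  -- letters when p is odd.
  by_cases he : Even p
  · have := key i j hij hp
    rcases Nat.eq_zero_or_pos p with h0 | h0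
    · subst h0; simpa [alternatingWord] using this
    rwa [listTake_alternatingWord i j p p (by omega), if_pos he] at this
  · have := key j i hij.symm (by rwa [M.symmetric j i])
    rcases Nat.eq_zero_or_pos p with h0 | h0
    · subst h0; simp at he
    rwa [listTake_alternatingWord j i p p (by omega), if_neg he] at this

end CoxeterSystem

/-! ### Matsumoto's theorem and the basis z_w -/

namespace CoxeterSystem

variable {B W : Type*} [Group W] {M : CoxeterMatrix B} (cs : CoxeterSystem M W)

theorem IsReduced.of_append_left {cs : CoxeterSystem M W} {ω ω' : List B}
    (h : cs.IsReduced (ω ++ ω')) : cs.IsReduced ω := by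
  simpa using h.take ω.length

theorem IsReduced.of_append_right {cs : CoxeterSystem M W} {ω ω' : List B}
    (h : cs.IsReduced (ω ++ ω')) : cs.IsReduced ω' := by
  simpa using h.drop ω.length

theorem isReduced_append_singleton_iff {ω : List B} {i : B} (h : cs.IsReduced ω) :
    cs.IsReduced (ω ++ [i]) ↔ ¬ cs.IsRightDescent (cs.wordProd ω) i := by
  rw [not_isRightDescent_iff, IsReduced, wordProd_append, wordProd_singleton, h.eq]
  simp

theorem isReduced_cons_iff {ω : List B} {i : B} (h : cs.IsReduced ω) :
    cs.IsReduced (i :: ω) ↔ ¬ cs.IsLeftDescent (cs.wordProd ω) i := by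
  rw [not_isLeftDescent_iff, IsReduced, wordProd_cons, h.eq]
  simp

theorem isRightDescent_of_isReduced {ω : List B} {i : B} (h : cs.IsReduced (ω ++ [i])) :
    cs.IsRightDescent (cs.wordProd (ω ++ [i])) i := by
  have h' := h.of_append_left
  rw [isRightDescent_iff, h.eq, wordProd_append, wordProd_singleton, simple_mul_simple_cancel_right,
    h'.eq]
  simp

/-- Exchange with the descent j deletes a letter from a word ending in i. If the letter lies in the
prefix, appending j lengthens the alternating tail; if it lies in the tail, the reduced alternating
word of length p + 1 would have a shorter expression. -/
theorem exists_isReduced_append_alternatingWord {w : W} (p : ℕ) :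
    ∀ {i j : B}, i ≠ j → cs.IsRightDescent w i → cs.IsRightDescent w j →
      (M i j = 0 ∨ p ≤ M i j) →
      ∃ ω, cs.IsReduced (ω ++ alternatingWord i j p) ∧
        w = cs.wordProd (ω ++ alternatingWord i j p) := by
  induction p with
  | zero =>
    intro i j _ _ _ _
    simpa [alternatingWord] using cs.exists_isReduced w
  | succ p ih =>
    intro i j hij hi hj hp
    have hp' : M j i = 0 ∨ p + 1 ≤ M j i := by rwa [M.symmetric j i]
    obtain ⟨ω, hω, hw⟩ := ih hij.symm hj hi (by omega)
    rw [hw] at hj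
    obtain ⟨k, hk, he⟩ := cs.exists_mul_eq_wordProd_eraseIdx
      ((cs.isRightInversion_simple_iff_isRightDescent _ _).mpr hj)
    rcases lt_or_ge k ω.length with hlt | hge
    · rw [List.eraseIdx_append_of_lt_length hlt] at he
      refine ⟨ω.eraseIdx k, ?_⟩
      have hw' : w = cs.wordProd (ω.eraseIdx k ++ alternatingWord i j (p + 1)) := by
        rw [alternatingWord_succ, List.concat_eq_append, ← List.append_assoc, wordProd_append _ _ [j],
          ← he, wordProd_singleton, simple_mul_simple_cancel_right, hw]
      refine ⟨?_, hw'⟩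
      rw [IsReduced, ← hw', hw, hω.eq]
      have := List.length_eraseIdx_add_one hlt
      simp
      omega
    · exfalso
      rw [List.eraseIdx_append_of_length_le hge, wordProd_append, wordProd_append, mul_assoc,
        mul_right_inj, ← wordProd_concat, ← alternatingWord_succ] at he
      have hred := cs.isReduced_alternatingWord hij hp
      have h1 := hred.eq
      rw [he] at h1
      have h2 := cs.length_wordProd_le ((alternatingWord j i p).eraseIdx (k - ω.length))
      have h3 := List.length_eraseIdx_le (alternatingWord j i p) (k - ω.length)
      simp only [length_alternatingWord] at h1 h3
      omega

theorem coxeterMatrix_ne_zero {w : W} {i j : B} (hij : i ≠ j) (hi : cs.IsRightDescent w i)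
    (hj : cs.IsRightDescent w j) : M i j ≠ 0 := by
  intro h0
  obtain ⟨ω, hω, hw⟩ :=
    cs.exists_isReduced_append_alternatingWord (cs.length w + 1) hij hi hj (Or.inl h0)
  have := hω.eq
  rw [← hw] at this
  simp at this
  omega

/-- Matsumoto's theorem. -/
theorem IsReduced.map_prod_eq {cs : CoxeterSystem M W} {G : Type*} [Monoid G] {f : B → G}
    (hf : ∀ i j, ((alternatingWord i j (M i j)).map f).prod
      = ((alternatingWord j i (M i j)).map f).prod)
    {ω ω' : List B} (hω : cs.IsReduced ω) (hω' : cs.IsReduced ω')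
    (h : cs.wordProd ω = cs.wordProd ω') : (ω.map f).prod = (ω'.map f).prod := by
  obtain ⟨n, hn⟩ : ∃ n, n = ω.length := ⟨_, rfl⟩
  have hlen : ω'.length = n := by rw [hn, ← hω.eq, ← hω'.eq, h]
  induction n generalizing ω ω' with
  | zero =>
    rw [List.length_eq_zero_iff.mp hn.symm, List.length_eq_zero_iff.mp hlen]
  | succ n ih =>
    have step : ∀ (α β : List B) (a : B), cs.IsReduced (α ++ [a]) → cs.IsReduced (β ++ [a]) →
        cs.wordProd (α ++ [a]) = cs.wordProd (β ++ [a]) → (α ++ [a]).length = n + 1 →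
        ((α ++ [a]).map f).prod = ((β ++ [a]).map f).prod := by
      intro α β a hα hβ he hl
      have hl' : (β ++ [a]).length = n + 1 := by rw [← hl, ← hα.eq, ← hβ.eq, he]
      rw [wordProd_append, wordProd_append, mul_left_inj] at he
      simp only [List.length_append, List.length_singleton, Nat.add_right_cancel_iff] at hl hl'
      rw [List.map_append, List.map_append, List.prod_append, List.prod_append,
        ih hα.of_append_left hβ.of_append_left he hl.symm hl']
    obtain ⟨α, i, rfl⟩ : ∃ α i, ω = α ++ [i] :=
      ⟨_, _, (List.dropLast_append_getLast (by rintro rfl; simp at hn)).symm⟩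
    obtain ⟨β, j, rfl⟩ : ∃ β j, ω' = β ++ [j] :=
      ⟨_, _, (List.dropLast_append_getLast (by rintro rfl; simp at hlen)).symm⟩
    by_cases hij : i = j
    · subst hij
      exact step α β i hω hω' h hn.symm
    have hi := cs.isRightDescent_of_isReduced hω
    have hj := cs.isRightDescent_of_isReduced hω'
    rw [← h] at hj
    have h0 := cs.coxeterMatrix_ne_zero hij hi hj
    -- The words `ρ` followed by either braid word join `ω` to `ω'`: one ends in i, the other in j,
    -- so `step` applies at both ends and `hf` in the middle.
    obtain ⟨ρ, hρ, hρw⟩ :=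
      cs.exists_isReduced_append_alternatingWord (M i j) hij hi hj (Or.inr le_rfl)
    have hprod : cs.wordProd (ρ ++ alternatingWord i j (M i j))
        = cs.wordProd (ρ ++ alternatingWord j i (M i j)) := by
      have := cs.wordProd_braidWord_eq i j
      rw [braidWord, braidWord, M.symmetric j i] at this
      rw [wordProd_append, wordProd_append, this]
    have hρ' : cs.IsReduced (ρ ++ alternatingWord j i (M i j)) := by
      rw [IsReduced, ← hprod, hρ.eq]
      simp
    have hfρ : ((ρ ++ alternatingWord i j (M i j)).map f).prod
        = ((ρ ++ alternatingWord j i (M i j)).map f).prod := by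
      rw [List.map_append, List.map_append, List.prod_append, List.prod_append, hf]
    obtain ⟨m, hm⟩ := Nat.exists_eq_succ_of_ne_zero h0
    rw [hm] at hfρ hprod hρ hρ' hρw
    rw [alternatingWord_succ, alternatingWord_succ, List.concat_eq_append, List.concat_eq_append,
      ← List.append_assoc, ← List.append_assoc] at hfρ hprod
    rw [alternatingWord_succ, List.concat_eq_append, ← List.append_assoc] at hρ hρ' hρw
    rw [step _ _ i hω hρ' (hρw.trans hprod) hn.symm, ← hfρ]
    exact (step _ _ j hω' hρ (h.symm.trans hρw) hlen).symm

theorem heckeGen_mul_self (i : B) : M.heckeGen i * M.heckeGen i = M.heckeGen i := by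
  rw [CoxeterMatrix.heckeGen, PresentedMonoid.of, ← map_mul]
  exact PresentedMonoid.mk_eq_mk_of_rel (CoxeterMatrix.ZeroHeckeRel.idem i)

theorem prod_map_heckeGen (ω : List B) :
    (ω.map M.heckeGen).prod = PresentedMonoid.mk M.ZeroHeckeRel (FreeMonoid.ofList ω) := by
  induction ω with
  | nil => simp
  | cons i ω ih =>
    rw [List.map_cons, List.prod_cons, ih, FreeMonoid.ofList_cons, map_mul]
    rfl

theorem heckeElt_wordProd {ω : List B} (hω : cs.IsReduced ω) :
    cs.heckeElt (cs.wordProd ω) = (ω.map M.heckeGen).prod := by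
  have hc := (cs.exists_isReduced (cs.wordProd ω)).choose_spec
  refine IsReduced.map_prod_eq (cs := cs) (fun i j => ?_) hc.1 hω hc.2.symm
  rw [prod_map_heckeGen, prod_map_heckeGen]
  exact PresentedMonoid.mk_eq_mk_of_rel (CoxeterMatrix.ZeroHeckeRel.braid i j)

theorem heckeElt_one : cs.heckeElt 1 = 1 := by
  simpa using cs.heckeElt_wordProd (ω := []) (by simp [IsReduced])

theorem heckeGen_mul_heckeElt_of_not_isLeftDescent {w : W} {i : B} (h : ¬ cs.IsLeftDescent w i) :
    M.heckeGen i * cs.heckeElt w = cs.heckeElt (cs.simple i * w) := by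
  obtain ⟨ω, hω, rfl⟩ := cs.exists_isReduced w
  rw [heckeElt_wordProd _ hω, ← wordProd_cons,
    heckeElt_wordProd _ ((cs.isReduced_cons_iff hω).mpr h), List.map_cons, List.prod_cons]

theorem heckeGen_mul_heckeElt_of_isLeftDescent {w : W} {i : B} (h : cs.IsLeftDescent w i) :
    M.heckeGen i * cs.heckeElt w = cs.heckeElt w := by
  have h1 := cs.heckeGen_mul_heckeElt_of_not_isLeftDescent
    (cs.isLeftDescent_iff_not_isLeftDescent_mul.mp h)
  rw [simple_mul_simple_cancel_left] at h1
  rw [← h1, ← mul_assoc, heckeGen_mul_self]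

theorem heckeElt_mul_heckeGen_of_not_isRightDescent {w : W} {i : B}
    (h : ¬ cs.IsRightDescent w i) :
    cs.heckeElt w * M.heckeGen i = cs.heckeElt (w * cs.simple i) := by
  obtain ⟨ω, hω, rfl⟩ := cs.exists_isReduced w
  rw [heckeElt_wordProd _ hω, ← wordProd_singleton, ← wordProd_append,
    heckeElt_wordProd _ ((cs.isReduced_append_singleton_iff hω).mpr h)]
  simp

theorem heckeElt_mul_heckeGen_of_isRightDescent {w : W} {i : B} (h : cs.IsRightDescent w i) :
    cs.heckeElt w * M.heckeGen i = cs.heckeElt w := by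
  have h1 := cs.heckeElt_mul_heckeGen_of_not_isRightDescent
    (cs.isRightDescent_iff_not_isRightDescent_mul.mp h)
  rw [simple_mul_simple_cancel_right] at h1
  rw [← h1, mul_assoc, heckeGen_mul_self]

theorem zeroHecke_induction {p : M.ZeroHecke → Prop} (h : M.ZeroHecke) (one : p 1)
    (gen_mul : ∀ i x, p x → p (M.heckeGen i * x)) : p h := by
  obtain ⟨ω, rfl⟩ := PresentedMonoid.surjective_mk h
  have key : ∀ l : List B, p (l.map M.heckeGen).prod := by
    intro l
    induction l with
    | nil => simpa using one
    | cons i l ih =>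
      rw [List.map_cons, List.prod_cons]
      exact gen_mul i _ ih
  have := key (FreeMonoid.toList ω)
  rwa [prod_map_heckeGen, FreeMonoid.ofList_toList] at this

theorem heckeElt_surjective : Function.Surjective cs.heckeElt := by
  intro h
  refine zeroHecke_induction (p := fun x => ∃ w, cs.heckeElt w = x) h ⟨1, cs.heckeElt_one⟩ ?_
  rintro i _ ⟨w, rfl⟩
  by_cases hd : cs.IsLeftDescent w i
  · exact ⟨w, (cs.heckeGen_mul_heckeElt_of_isLeftDescent hd).symm⟩
  · exact ⟨_, (cs.heckeGen_mul_heckeElt_of_not_isLeftDescent hd).symm⟩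

open Classical in
/-- Left Demazure multiplication by a simple reflection. -/
noncomputable def leftDemazure (i : B) : Function.End W :=
  fun w => if cs.IsLeftDescent w i then w else cs.simple i * w

open Classical in
/-- Right Demazure multiplication by a simple reflection. -/
noncomputable def rightDemazure (i : B) : Function.End W :=
  fun w => if cs.IsRightDescent w i then w else w * cs.simple i

/-- Exchange in a reduced word of w followed by j must delete the final j, since deleting a letter
of w would make i a left descent of w. -/
theorem simple_mul_eq_mul_simple {w : W} {i j : B} (hi : ¬ cs.IsLeftDescent w i)
    (h : cs.IsLeftDescent (w * cs.simple j) i) : cs.simple i * w = w * cs.simple j := by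
  obtain ⟨ω, hω, rfl⟩ := cs.exists_isReduced w
  rw [← wordProd_singleton, ← wordProd_append] at h
  obtain ⟨k, hk, he⟩ := cs.exists_simple_mul_eq_wordProd_eraseIdx h
  rcases lt_or_ge k ω.length with hlt | hge
  · exfalso
    rw [List.eraseIdx_append_of_lt_length hlt, wordProd_append, wordProd_append, ← mul_assoc,
      mul_left_inj] at he
    rw [not_isLeftDescent_iff, he, hω.eq] at hi
    have h2 := cs.length_wordProd_le (ω.eraseIdx k)
    have h3 := List.length_eraseIdx_le ω k
    omega
  · have hk' : k = ω.length := by simp at hk; omega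
    rw [List.eraseIdx_append_of_length_le hge, hk'] at he
    simp only [Nat.sub_self, List.eraseIdx_cons_zero, List.append_nil, wordProd_append,
      wordProd_singleton] at he
    have := congrArg (fun x => cs.simple i * x) he
    simpa using this.symm

theorem leftDemazure_rightDemazure (i j : B) (w : W) :
    cs.leftDemazure i (cs.rightDemazure j w) = cs.rightDemazure j (cs.leftDemazure i w) := by
  have l1 := cs.length_mul_le (cs.simple i) (w * cs.simple j)
  have l2 := cs.length_mul_le (cs.simple i * w) (cs.simple j)
  rw [length_simple] at l1 l2
  have ha : cs.simple i * (w * cs.simple j) = cs.simple i * w * cs.simple j :=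
    (mul_assoc _ _ _).symm
  unfold leftDemazure rightDemazure
  by_cases hi : cs.IsLeftDescent w i <;> by_cases hj : cs.IsRightDescent w j
  · simp [hi, hj]
  · have : cs.IsLeftDescent (w * cs.simple j) i := by
      rw [not_isRightDescent_iff] at hj
      unfold IsLeftDescent at hi ⊢
      rw [ha]
      omega
    simp [hi, hj, this]
  · have : cs.IsRightDescent (cs.simple i * w) j := by
      rw [not_isLeftDescent_iff] at hi
      unfold IsRightDescent at hj ⊢
      rw [← ha]
      omega
    simp [hi, hj, this]
  · by_cases h : cs.IsLeftDescent (w * cs.simple j) i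
    · have he := cs.simple_mul_eq_mul_simple hi h
      have : cs.IsRightDescent (cs.simple i * w) j := by
        rw [he, isRightDescent_iff_not_isRightDescent_mul, simple_mul_simple_cancel_right]
        exact hj
      rw [he] at this
      simp [hi, hj, h, this, he]
    · have : ¬ cs.IsRightDescent (cs.simple i * w) j := by
        rw [not_isLeftDescent_iff] at hi h
        rw [not_isRightDescent_iff] at hj ⊢
        rw [← ha]
        omega
      simp [hi, hj, h, this, mul_assoc]

theorem prod_leftDemazure_rightDemazure (ω : List B) (j : B) (w : W) :
    (ω.map cs.leftDemazure).prod (cs.rightDemazure j w)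
      = cs.rightDemazure j ((ω.map cs.leftDemazure).prod w) := by
  induction ω with
  | nil => rfl
  | cons i ω ih =>
    rw [List.map_cons, List.prod_cons]
    change cs.leftDemazure i ((ω.map cs.leftDemazure).prod (cs.rightDemazure j w)) = _
    rw [ih, leftDemazure_rightDemazure]
    rfl

theorem prod_leftDemazure_one {ω : List B} (hω : cs.IsReduced ω) :
    (ω.map cs.leftDemazure).prod 1 = cs.wordProd ω := by
  induction ω with
  | nil => simp [Function.End.one_def]
  | cons i ω ih =>
    have hω' : cs.IsReduced ω := IsReduced.of_append_right (ω := [i]) hω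
    rw [List.map_cons, List.prod_cons]
    change cs.leftDemazure i ((ω.map cs.leftDemazure).prod 1) = _
    rw [ih hω', leftDemazure, if_neg ((cs.isReduced_cons_iff hω').mp hω), wordProd_cons]

/-- Every w arises from 1 by right Demazure steps, which commute with the left ones, so a product of
left operators is determined by its value at 1. This reduces the braid relations to an identity in
W. -/
theorem prod_leftDemazure_ext {ω ω' : List B}
    (h : (ω.map cs.leftDemazure).prod 1 = (ω'.map cs.leftDemazure).prod 1) :
    (ω.map cs.leftDemazure).prod = (ω'.map cs.leftDemazure).prod := by
  funext w
  obtain ⟨ρ, hρ, rfl⟩ := cs.exists_isReduced w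
  induction ρ using List.reverseRecOn with
  | nil => simpa using h
  | append_singleton ρ j ih =>
    have hρ' := hρ.of_append_left
    have : cs.wordProd (ρ ++ [j]) = cs.rightDemazure j (cs.wordProd ρ) := by
      rw [rightDemazure, if_neg ((cs.isReduced_append_singleton_iff hρ').mp hρ), wordProd_append,
        wordProd_singleton]
    rw [this, prod_leftDemazure_rightDemazure, prod_leftDemazure_rightDemazure, ih hρ']

theorem leftDemazure_rel (x y : FreeMonoid B) (h : M.ZeroHeckeRel x y) :
    FreeMonoid.lift cs.leftDemazure x = FreeMonoid.lift cs.leftDemazure y := by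
  cases h with
  | idem i =>
    rw [map_mul, FreeMonoid.lift_eval_of]
    funext w
    change cs.leftDemazure i (cs.leftDemazure i w) = cs.leftDemazure i w
    by_cases hi : cs.IsLeftDescent w i
    · simp [leftDemazure, hi]
    · have : cs.IsLeftDescent (cs.simple i * w) i := by
        rwa [isLeftDescent_iff_not_isLeftDescent_mul, simple_mul_simple_cancel_left]
      simp [leftDemazure, hi, this]
  | braid i j =>
    rw [FreeMonoid.lift_ofList, FreeMonoid.lift_ofList]
    by_cases hij : i = j
    · subst hij; rfl
    apply cs.prod_leftDemazure_ext
    have := cs.wordProd_braidWord_eq i j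
    rw [braidWord, braidWord, M.symmetric j i] at this
    rw [prod_leftDemazure_one _ (cs.isReduced_alternatingWord hij (Or.inr le_rfl)),
      prod_leftDemazure_one _ (cs.isReduced_alternatingWord (Ne.symm hij)
        (Or.inr (M.symmetric i j).le)), this]

/-- The action of the `0`-Hecke monoid on `W` by left Demazure multiplication. -/
noncomputable def demazureAction : M.ZeroHecke →* Function.End W :=
  PresentedMonoid.lift cs.leftDemazure cs.leftDemazure_rel

theorem demazureAction_heckeElt_one (w : W) : cs.demazureAction (cs.heckeElt w) 1 = w := by
  obtain ⟨ω, hω, rfl⟩ := cs.exists_isReduced w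
  rw [heckeElt_wordProd _ hω, map_list_prod, List.map_map]
  exact cs.prod_leftDemazure_one hω

theorem heckeElt_injective : Function.Injective cs.heckeElt :=
  fun v w h => by rw [← cs.demazureAction_heckeElt_one v, h, demazureAction_heckeElt_one]

end CoxeterSystem

/-! ### Parabolic subgroups and lengths of products -/

namespace CoxeterSystem

variable {B W : Type*} [Group W] {M : CoxeterMatrix B} (cs : CoxeterSystem M W)

theorem wordProd_mem_parabolic {J : Set B} {ω : List B} (h : ∀ i ∈ ω, i ∈ J) :
    cs.wordProd ω ∈ cs.parabolic J := by
  induction ω with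
  | nil => simp
  | cons i ω ih =>
    rw [wordProd_cons]
    exact mul_mem (Subgroup.subset_closure ⟨i, h i (by simp), rfl⟩)
      (ih fun j hj => h j (by simp [hj]))

/-- Exchange only deletes letters, so reducing a word never leaves J. -/
theorem exists_isReduced_of_forall_mem {J : Set B} (ω : List B) (h : ∀ i ∈ ω, i ∈ J) :
    ∃ ω', cs.IsReduced ω' ∧ (∀ i ∈ ω', i ∈ J) ∧ cs.wordProd ω = cs.wordProd ω' := by
  induction ω with
  | nil => exact ⟨[], by simp [IsReduced], by simp, rfl⟩
  | cons i ω ih =>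
    obtain ⟨ω', hω', hJ, he⟩ := ih fun j hj => h j (by simp [hj])
    rw [wordProd_cons, he]
    by_cases hd : cs.IsLeftDescent (cs.wordProd ω') i
    · obtain ⟨k, hk, hk'⟩ := cs.exists_simple_mul_eq_wordProd_eraseIdx hd
      refine ⟨ω'.eraseIdx k, ?_, fun j hj => hJ j (List.mem_of_mem_eraseIdx hj), hk'⟩
      rw [isLeftDescent_iff, hk', hω'.eq] at hd
      have := List.length_eraseIdx_add_one hk
      rw [IsReduced]
      omega
    · refine ⟨i :: ω', (cs.isReduced_cons_iff hω').mpr hd, ?_, (cs.wordProd_cons _ _).symm⟩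
      intro j hj
      rcases List.mem_cons.mp hj with rfl | hj
      · exact h j (by simp)
      · exact hJ j hj

theorem exists_isReduced_of_mem_parabolic {J : Set B} {w : W} (hw : w ∈ cs.parabolic J) :
    ∃ ω, cs.IsReduced ω ∧ (∀ i ∈ ω, i ∈ J) ∧ w = cs.wordProd ω := by
  obtain ⟨ω, hω, rfl⟩ : ∃ ω : List B, (∀ i ∈ ω, i ∈ J) ∧ cs.wordProd ω = w := by
    induction hw using Subgroup.closure_induction with
    | mem x hx =>
      obtain ⟨i, hi, rfl⟩ := hx
      exact ⟨[i], by simpa using hi, by simp⟩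
    | one => exact ⟨[], by simp, by simp⟩
    | mul x y _ _ hx hy =>
      obtain ⟨α, hα, rfl⟩ := hx
      obtain ⟨β, hβ, rfl⟩ := hy
      refine ⟨α ++ β, fun i hi => ?_, by simp [wordProd_append]⟩
      rcases List.mem_append.mp hi with h | h
      exacts [hα i h, hβ i h]
    | inv x _ hx =>
      obtain ⟨α, hα, rfl⟩ := hx
      exact ⟨α.reverse, by simpa using hα, by simp⟩
  exact cs.exists_isReduced_of_forall_mem ω hω

open Classical in
theorem character_heckeElt (k : Type*) [Field k] (J : Set B) (w : W) :
    M.character k J (cs.heckeElt w) = if w ∈ cs.parabolic J then 1 else 0 := by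
  have key : ∀ ω : List B, M.character k J (ω.map M.heckeGen).prod
      = if ∀ i ∈ ω, i ∈ J then 1 else 0 := by
    intro ω
    induction ω with
    | nil => simp
    | cons i ω ih =>
      rw [List.map_cons, List.prod_cons, map_mul, ih, CoxeterMatrix.character,
        CoxeterMatrix.heckeGen, PresentedMonoid.lift_of]
      by_cases hi : i ∈ J <;> simp [hi]
  split_ifs with h
  · obtain ⟨ω, hω, hJ, rfl⟩ := cs.exists_isReduced_of_mem_parabolic h
    rw [heckeElt_wordProd _ hω, key, if_pos hJ]
  · obtain ⟨ω, hω, rfl⟩ := cs.exists_isReduced w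
    rw [heckeElt_wordProd _ hω, key, if_neg fun hJ => h (cs.wordProd_mem_parabolic hJ)]

theorem heckeElt_mul_of_length_eq {v w : W}
    (h : cs.length (v * w) = cs.length v + cs.length w) :
    cs.heckeElt v * cs.heckeElt w = cs.heckeElt (v * w) := by
  obtain ⟨α, hα, rfl⟩ := cs.exists_isReduced v
  obtain ⟨β, hβ, rfl⟩ := cs.exists_isReduced w
  have hred : cs.IsReduced (α ++ β) := by
    rw [IsReduced, wordProd_append, h, hα.eq, hβ.eq, List.length_append]
  rw [← wordProd_append, heckeElt_wordProd _ hα, heckeElt_wordProd _ hβ, heckeElt_wordProd _ hred,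
    List.map_append, List.prod_append]

/-- Each generator raises the length by at most one; in the case of equality none is absorbed and
the product is the one in W. -/
theorem length_le_of_heckeElt_mul_eq {u v w : W}
    (h : cs.heckeElt v * cs.heckeElt w = cs.heckeElt u) :
    cs.length u ≤ cs.length v + cs.length w ∧
      (cs.length u = cs.length v + cs.length w → u = v * w) := by
  obtain ⟨ω, hω, rfl⟩ := cs.exists_isReduced v
  induction ω generalizing u with
  | nil =>
    rw [wordProd_nil, heckeElt_one, one_mul] at h
    simp [cs.heckeElt_injective h]
  | cons i ω ih =>
    have hω' : cs.IsReduced ω := IsReduced.of_append_right (ω := [i]) hω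
    obtain ⟨u', hu'⟩ := cs.heckeElt_surjective (cs.heckeElt (cs.wordProd ω) * cs.heckeElt w)
    obtain ⟨h1, h2⟩ := ih hω' hu'.symm
    rw [wordProd_cons, ← heckeGen_mul_heckeElt_of_not_isLeftDescent _
      ((cs.isReduced_cons_iff hω').mp hω), mul_assoc, ← hu'] at h
    rw [hω'.eq] at h1 h2
    rw [hω.eq, List.length_cons, wordProd_cons]
    by_cases hd : cs.IsLeftDescent u' i
    · rw [heckeGen_mul_heckeElt_of_isLeftDescent _ hd] at h
      rw [← cs.heckeElt_injective h]
      omega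
    · rw [heckeGen_mul_heckeElt_of_not_isLeftDescent _ hd] at h
      rw [not_isLeftDescent_iff] at hd
      rw [← cs.heckeElt_injective h, hd]
      refine ⟨by omega, fun he => ?_⟩
      rw [h2 (by omega), mul_assoc]

theorem mul_prod_map_heckeGen_eq {J : Set B} {ω : List B} (hω : ∀ i ∈ ω, i ∈ J) {x : M.ZeroHecke}
    (h : ∀ i ∈ J, x * M.heckeGen i = x) : x * (ω.map M.heckeGen).prod = x := by
  induction ω with
  | nil => simp
  | cons i ω ih =>
    rw [List.map_cons, List.prod_cons, ← mul_assoc, h i (hω i (by simp)),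
      ih fun j hj => hω j (by simp [hj])]

theorem ncard_isRightInversion (w : W) : {t | cs.IsRightInversion w t}.ncard = cs.length w := by
  classical
  obtain ⟨ω, hω, rfl⟩ := cs.exists_isReduced w
  have : {t | cs.IsRightInversion (cs.wordProd ω) t} = ((cs.rightInvSeq ω).toFinset : Set W) := by
    ext t
    simp only [Set.mem_ofPred_eq, List.coe_toFinset]
    exact ⟨cs.mem_rightInvSeq_of_isRightInversion, cs.isRightInversion_of_mem_rightInvSeq hω⟩
  rw [this, Set.ncard_coe_finset, List.toFinset_card_of_nodup hω.nodup_rightInvSeq,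
    length_rightInvSeq, hω.eq]

/-! ### The longest element and the zero of the monoid -/

section Finite

variable [Finite W]

theorem isRightDescent_longestOf {J : Set B} {i : B} (hi : i ∈ J) :
    cs.IsRightDescent (cs.longestOf J) i := by
  have h := (cs.exists_longest J).choose_spec
  have h1 := h.2 _ (mul_mem h.1 (Subgroup.subset_closure ⟨i, hi, rfl⟩))
  exact lt_of_le_of_ne h1 (cs.length_mul_simple_ne _ _)

theorem isLeftDescent_longestOf {J : Set B} {i : B} (hi : i ∈ J) :
    cs.IsLeftDescent (cs.longestOf J) i := by
  have h := (cs.exists_longest J).choose_spec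
  have h1 := h.2 _ (mul_mem (Subgroup.subset_closure ⟨i, hi, rfl⟩) h.1)
  exact lt_of_le_of_ne h1 (cs.length_simple_mul_ne _ _)

theorem length_le_length_longest (w : W) : cs.length w ≤ cs.length cs.longest := by
  refine (cs.exists_longest Set.univ).choose_spec.2 w ?_
  obtain ⟨ω, rfl⟩ := cs.wordProd_surjective w
  exact cs.wordProd_mem_parabolic (by simp)

theorem isRightInversion_longest {t : W} (ht : cs.IsReflection t) :
    cs.IsRightInversion cs.longest t :=
  ⟨ht, lt_of_le_of_ne (cs.length_le_length_longest _) (ht.length_mul_left_ne _)⟩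

/-- Every reflection is an inversion of w_0, so left multiplication by w_0 flips every parity.
Counting inversions then gives ℓ(w_0 w) = ℓ(w_0) - ℓ(w). -/
theorem isRightInversion_longest_mul_iff {w t : W} (ht : cs.IsReflection t) :
    cs.IsRightInversion (cs.longest * w) t ↔ ¬ cs.IsRightInversion w t := by
  have h1 := (cs.isRightInversion_iff_inversionParity (ht.conj w)).mp
    (cs.isRightInversion_longest (ht.conj w))
  rw [isRightInversion_iff_inversionParity _ ht, isRightInversion_iff_inversionParity _ ht,
    inversionParity_mul, h1]
  generalize cs.inversionParity w t = x
  revert x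
  decide

theorem length_longest_mul (w : W) :
    cs.length (cs.longest * w) + cs.length w = cs.length cs.longest := by
  rw [← ncard_isRightInversion, ← ncard_isRightInversion, ← ncard_isRightInversion,
    ← Set.ncard_union_eq ?_ (Set.toFinite _) (Set.toFinite _)]
  · congr 1
    ext t
    constructor
    · rintro (h | h) <;> exact cs.isRightInversion_longest h.1
    · intro h
      by_cases hw : cs.IsRightInversion w t
      · exact Or.inr hw
      · exact Or.inl ((cs.isRightInversion_longest_mul_iff h.1).mpr hw)
  · rw [Set.disjoint_left]
    intro t h h'
    exact (cs.isRightInversion_longest_mul_iff h'.1).mp h h'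

theorem longest_mul_longest : cs.longest * cs.longest = 1 := by
  rw [← cs.length_eq_zero_iff]
  have := cs.length_longest_mul cs.longest
  omega

theorem longest_mul_longest_mul (w : W) : cs.longest * (cs.longest * w) = w := by
  rw [← mul_assoc, longest_mul_longest, one_mul]

theorem longest_inv : cs.longest⁻¹ = cs.longest :=
  inv_eq_of_mul_eq_one_left cs.longest_mul_longest

theorem length_mul_longest (w : W) :
    cs.length (w * cs.longest) + cs.length w = cs.length cs.longest := by
  have := cs.length_longest_mul w⁻¹
  rwa [length_inv, ← length_inv, mul_inv_rev, inv_inv, longest_inv] at this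

theorem length_longest_mul_mul_longest (w : W) :
    cs.length (cs.longest * w * cs.longest) = cs.length w := by
  have h1 := cs.length_mul_longest (cs.longest * w)
  have h2 := cs.length_longest_mul w
  omega

theorem exists_simple_eq_longest_conj (i : B) :
    ∃ j, cs.simple j = cs.longest * cs.simple i * cs.longest := by
  obtain ⟨j, hj⟩ := cs.length_eq_one_iff.mp
    ((cs.length_longest_mul_mul_longest (cs.simple i)).trans (cs.length_simple i))
  exact ⟨j, hj.symm⟩

theorem isLeftDescent_longest (i : B) : cs.IsLeftDescent cs.longest i :=
  cs.isLeftDescent_longestOf (Set.mem_univ i)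

theorem isRightDescent_longest (i : B) : cs.IsRightDescent cs.longest i :=
  cs.isRightDescent_longestOf (Set.mem_univ i)

theorem heckeGen_mul_heckeElt_eq_heckeZero_iff (i : B) (w : W) :
    M.heckeGen i * cs.heckeElt w = cs.heckeZero ↔ w = cs.longest ∨ w = cs.simple i * cs.longest := by
  have hl := cs.isLeftDescent_longest i
  by_cases hd : cs.IsLeftDescent w i
  · rw [heckeGen_mul_heckeElt_of_isLeftDescent _ hd, heckeZero, cs.heckeElt_injective.eq_iff]
    refine ⟨Or.inl, ?_⟩
    rintro (rfl | rfl)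
    · rfl
    · exact absurd hd (cs.isLeftDescent_iff_not_isLeftDescent_mul.mp hl)
  · rw [heckeGen_mul_heckeElt_of_not_isLeftDescent _ hd, heckeZero, cs.heckeElt_injective.eq_iff]
    constructor
    · intro h
      rw [← h, simple_mul_simple_cancel_left]
      exact Or.inr rfl
    · rintro (rfl | rfl)
      · exact absurd hl hd
      · rw [simple_mul_simple_cancel_left]

theorem heckeElt_mul_heckeGen_eq_heckeZero_iff (i : B) (w : W) :
    cs.heckeElt w * M.heckeGen i = cs.heckeZero ↔ w = cs.longest ∨ w = cs.longest * cs.simple i := by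
  have hl := cs.isRightDescent_longest i
  by_cases hd : cs.IsRightDescent w i
  · rw [heckeElt_mul_heckeGen_of_isRightDescent _ hd, heckeZero, cs.heckeElt_injective.eq_iff]
    refine ⟨Or.inl, ?_⟩
    rintro (rfl | rfl)
    · rfl
    · exact absurd hd (cs.isRightDescent_iff_not_isRightDescent_mul.mp hl)
  · rw [heckeElt_mul_heckeGen_of_not_isRightDescent _ hd, heckeZero, cs.heckeElt_injective.eq_iff]
    constructor
    · intro h
      rw [← h, simple_mul_simple_cancel_right]
      exact Or.inr rfl
    · rintro (rfl | rfl)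
      · exact absurd hl hd
      · rw [simple_mul_simple_cancel_right]

theorem heckeIdem_eq_prod (J : Set B) :
    ∃ ω : List B, (∀ i ∈ ω, i ∈ J) ∧ cs.heckeIdem J = (ω.map M.heckeGen).prod := by
  obtain ⟨ω, hω, hJ, he⟩ := cs.exists_isReduced_of_mem_parabolic (cs.exists_longest J).choose_spec.1
  refine ⟨ω, hJ, ?_⟩
  rw [heckeIdem, longestOf, he, heckeElt_wordProd _ hω]

theorem heckeIdem_mul_heckeGen {J : Set B} {i : B} (hi : i ∈ J) :
    cs.heckeIdem J * M.heckeGen i = cs.heckeIdem J :=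
  cs.heckeElt_mul_heckeGen_of_isRightDescent (cs.isRightDescent_longestOf hi)

theorem mul_heckeIdem {J : Set B} {x : M.ZeroHecke} (h : ∀ i ∈ J, x * M.heckeGen i = x) :
    x * cs.heckeIdem J = x := by
  obtain ⟨ω, hω, he⟩ := cs.heckeIdem_eq_prod J
  rw [he, mul_prod_map_heckeGen_eq hω h]

theorem heckeIdem_mul_self (J : Set B) : cs.heckeIdem J * cs.heckeIdem J = cs.heckeIdem J :=
  cs.mul_heckeIdem fun _ => cs.heckeIdem_mul_heckeGen

theorem mul_heckeZero (x : M.ZeroHecke) : x * cs.heckeZero = cs.heckeZero := by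
  refine zeroHecke_induction (p := fun x => x * cs.heckeZero = cs.heckeZero) x (one_mul _) fun i x hx => ?_
  rw [mul_assoc, hx]
  exact cs.heckeGen_mul_heckeElt_of_isLeftDescent (cs.isLeftDescent_longest i)

theorem heckeZero_mul (x : M.ZeroHecke) : cs.heckeZero * x = cs.heckeZero := by
  refine zeroHecke_induction (p := fun x => cs.heckeZero * x = cs.heckeZero) x (mul_one _)
    fun i x hx => ?_
  rw [← mul_assoc, heckeZero, cs.heckeElt_mul_heckeGen_of_isRightDescent
    (cs.isRightDescent_longest i)]
  exact hx

end Finite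

end CoxeterSystem

/-! ### Characters and projectivity of idempotent ideals -/

theorem CoxeterMatrix.character_heckeGen_of_mem {B : Type*} {M : CoxeterMatrix B} (k : Type*)
    [Field k] {J : Set B} {i : B} (hi : i ∈ J) : M.character k J (M.heckeGen i) = 1 := by
  rw [CoxeterMatrix.character, CoxeterMatrix.heckeGen, PresentedMonoid.lift_of, if_pos hi]

theorem CoxeterMatrix.character_heckeGen_of_notMem {B : Type*} {M : CoxeterMatrix B} (k : Type*)
    [Field k] {J : Set B} {i : B} (hi : i ∉ J) : M.character k J (M.heckeGen i) = 0 := by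
  rw [CoxeterMatrix.character, CoxeterMatrix.heckeGen, PresentedMonoid.lift_of, if_neg hi]

theorem CoxeterMatrix.theta_apply {B : Type*} (M : CoxeterMatrix B) (k : Type*) [Field k]
    (J : Set B) (h : M.ZeroHecke) (c : k) : M.theta k J h c = M.character k J h * c := rfl

theorem CoxeterMatrix.theta_asAlgebraHom_apply {B : Type*} (M : CoxeterMatrix B) (k : Type*)
    [Field k] (J : Set B) (a : MonoidAlgebra k M.ZeroHecke) (c : k) :
    (M.theta k J).asAlgebraHom a c
      = MonoidAlgebra.lift k k M.ZeroHecke (M.character k J) a * c := by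
  induction a using MonoidAlgebra.induction_on with
  | of h => rw [Representation.asAlgebraHom_of, MonoidAlgebra.lift_of, M.theta_apply]
  | add x y hx hy => rw [map_add, map_add, LinearMap.add_apply, hx, hy, add_mul]
  | smul r x hx => rw [map_smul, map_smul, LinearMap.smul_apply, hx, smul_mul_assoc]

/-- The map a ↦ a f from A onto A f is split by the inclusion. -/
theorem IsIdempotentElem.projective_span_singleton {A : Type*} [Ring A] {f : A}
    (hf : IsIdempotentElem f) : Module.Projective A (Submodule.span A {f}) := by
  have hmem : f ∈ Submodule.span A {f} := Submodule.mem_span_singleton_self f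
  refine Module.Projective.of_split (Submodule.span A {f}).subtype
    (LinearMap.toSpanSingleton A _ ⟨f, hmem⟩) ?_
  ext ⟨x, hx⟩
  obtain ⟨a, rfl⟩ := Submodule.mem_span_singleton.mp hx
  simp [mul_assoc, hf.eq]

/-! ### The coefficient form and the socle generator -/

namespace CoxeterSystem

variable {B W : Type*} [Group W] {M : CoxeterMatrix B} (cs : CoxeterSystem M W)
  (k : Type*) [Field k]

local notation "A" => MonoidAlgebra k M.ZeroHecke
local notation "ι" => MonoidAlgebra.of k M.ZeroHecke

theorem of_mul_eq_or_eq_zero {x : A}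
    (hx : ∀ i, ι (M.heckeGen i) * x = x ∨ ι (M.heckeGen i) * x = 0) (h : M.ZeroHecke) :
    ι h * x = x ∨ ι h * x = 0 := by
  refine zeroHecke_induction (p := fun h => ι h * x = x ∨ ι h * x = 0) h
    (Or.inl (by rw [map_one, one_mul])) fun i y hy => ?_
  rw [map_mul, mul_assoc]
  rcases hy with hy | hy
  · rw [hy]; exact hx i
  · rw [hy, mul_zero]; exact Or.inr rfl

theorem mul_eq_lift_character_smul {J : Set B} {x : A}
    (h1 : ∀ i ∈ J, ι (M.heckeGen i) * x = x) (h0 : ∀ i ∉ J, ι (M.heckeGen i) * x = 0) (a : A) :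
    a * x = MonoidAlgebra.lift k k M.ZeroHecke (M.character k J) a • x := by
  induction a using MonoidAlgebra.induction_on with
  | of h =>
    rw [MonoidAlgebra.lift_of]
    refine zeroHecke_induction (p := fun h => ι h * x = M.character k J h • x) h
      (by rw [map_one, one_mul, map_one, one_smul])
      fun i y hy => ?_
    rw [map_mul, mul_assoc, hy, mul_smul_comm, map_mul]
    by_cases hi : i ∈ J
    · rw [h1 i hi, M.character_heckeGen_of_mem k hi, one_mul]
    · rw [h0 i hi, M.character_heckeGen_of_notMem k hi, zero_mul, smul_zero, zero_smul]
  | add y z hy hz => rw [add_mul, hy, hz, map_add, add_smul]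
  | smul r y hy => rw [smul_mul_assoc, hy, map_smul, smul_assoc]

variable [Finite W]

/-- The coefficient of the zero element `e_0` is a nondegenerate linear form. -/
theorem exists_coeff_heckeZero_ne_zero {x : A} (hx : x ≠ 0) :
    ∃ h, (ι h * x).coeff cs.heckeZero ≠ 0 := by
  have hne : {w | x.coeff (cs.heckeElt w) ≠ 0}.Nonempty := by
    by_contra hempty
    apply hx
    ext h
    obtain ⟨w, rfl⟩ := cs.heckeElt_surjective h
    by_contra hw
    exact hempty ⟨w, hw⟩
  obtain ⟨w, hw, hmax⟩ := Set.exists_max_image _ cs.length (Set.toFinite _) hne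
  -- No v in the support is longer than w, and ℓ(w_0 w⁻¹) = ℓ(w_0) - ℓ(w). So z_{w_0 w⁻¹} z_v = e_0
  -- forces equality of lengths and v = w.
  refine ⟨cs.heckeElt (cs.longest * w⁻¹), ?_⟩
  have hlen : cs.length (cs.longest * w⁻¹) + cs.length w = cs.length cs.longest := by
    rw [← cs.length_inv w]
    exact cs.length_longest_mul w⁻¹
  rw [MonoidAlgebra.of_apply,
    MonoidAlgebra.coeff_single_mul_eq_mul_coeff (m₂ := cs.heckeElt w), one_mul]
  · exact hw
  · intro h hh
    obtain ⟨v, rfl⟩ := cs.heckeElt_surjective h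
    constructor
    · intro he
      have hv := hmax v (Finsupp.mem_support_iff.mp hh)
      obtain ⟨h1, h2⟩ := cs.length_le_of_heckeElt_mul_eq he
      have h3 := h2 (by omega)
      rw [mul_assoc, left_eq_mul, inv_mul_eq_one] at h3
      rw [h3]
    · intro he
      rw [he, heckeElt_mul_of_length_eq, inv_mul_cancel_right, heckeZero]
      rw [inv_mul_cancel_right, hlen]

/-- Every monoid element sends x to x or 0, so the multiple with nonzero coefficient provided by
nondegeneracy is x itself. -/
theorem coeff_heckeZero_ne_zero {x : A} (hx : x ≠ 0)
    (h : ∀ i, ι (M.heckeGen i) * x = x ∨ ι (M.heckeGen i) * x = 0) :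
    x.coeff cs.heckeZero ≠ 0 := by
  obtain ⟨y, hy⟩ := cs.exists_coeff_heckeZero_ne_zero k hx
  rcases of_mul_eq_or_eq_zero k h y with h1 | h1
  · rwa [h1] at hy
  · rw [h1] at hy
    simp at hy

/-- The equation e_i z_w = e_0 has solutions w_0 and s_i w_0, while z_w e_j = e_0 has w_0 and w_0
s_j. These agree as w_0 s_j = s_i w_0. -/
theorem coeff_heckeGen_mul {i j : B} (hij : cs.simple j = cs.longest * cs.simple i * cs.longest)
    (x : A) : (ι (M.heckeGen i) * x).coeff cs.heckeZero
      = (x * ι (M.heckeGen j)).coeff cs.heckeZero := by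
  classical
  induction x using MonoidAlgebra.induction_on with
  | of h =>
    obtain ⟨w, rfl⟩ := cs.heckeElt_surjective h
    rw [← map_mul, ← map_mul, MonoidAlgebra.of_apply, MonoidAlgebra.of_apply,
      MonoidAlgebra.coeff_single, MonoidAlgebra.coeff_single, Finsupp.single_apply,
      Finsupp.single_apply,
      heckeGen_mul_heckeElt_eq_heckeZero_iff, heckeElt_mul_heckeGen_eq_heckeZero_iff, hij,
      mul_assoc, longest_mul_longest_mul]
  | add x y hx hy =>
    rw [mul_add, add_mul, MonoidAlgebra.coeff_add, MonoidAlgebra.coeff_add, Finsupp.add_apply,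
      Finsupp.add_apply, hx, hy]
  | smul r x hx =>
    rw [mul_smul_comm, smul_mul_assoc, MonoidAlgebra.coeff_smul_apply,
      MonoidAlgebra.coeff_smul_apply, hx]

/-- Every nonzero submodule of the regular module contains a nonzero vector on which each generator
acts as `0` or `1`. -/
theorem exists_mem_heckeGen_mul (cs : CoxeterSystem M W) {N : Submodule A A} (hN : N ≠ ⊥) :
    ∃ x ∈ N, x ≠ 0 ∧ ∀ i, ι (M.heckeGen i) * x = x ∨ ι (M.heckeGen i) * x = 0 := by
  obtain ⟨n, hn, hn0⟩ := Submodule.exists_mem_ne_zero_of_ne_bot hN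
  have hne : {w | ∃ n ∈ N, ι (cs.heckeElt w) * n ≠ 0}.Nonempty :=
    ⟨1, n, hn, by rwa [heckeElt_one, map_one, one_mul]⟩
  -- A longest z_w not annihilating N: a generator either is absorbed by it or lengthens it and so
  -- kills `n`.
  obtain ⟨w, ⟨n, hn, hnw⟩, hmax⟩ := Set.exists_max_image _ cs.length (Set.toFinite _) hne
  refine ⟨_, N.smul_mem _ hn, hnw, fun i => ?_⟩
  rw [smul_eq_mul, ← mul_assoc, ← map_mul]
  by_cases hd : cs.IsLeftDescent w i
  · rw [heckeGen_mul_heckeElt_of_isLeftDescent _ hd]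
    exact Or.inl rfl
  · right
    rw [heckeGen_mul_heckeElt_of_not_isLeftDescent _ hd]
    by_contra hne
    have := hmax _ ⟨n, hn, hne⟩
    rw [not_isLeftDescent_iff] at hd
    omega

theorem isIdempotentElem_heckeIdem_sub (J : Set B) :
    IsIdempotentElem (ι (cs.heckeIdem J) - ι cs.heckeZero) := by
  rw [IsIdempotentElem, sub_mul, mul_sub, mul_sub, ← map_mul, ← map_mul, ← map_mul, ← map_mul,
    heckeIdem_mul_self, mul_heckeZero, mul_heckeZero, heckeZero_mul]
  simp

variable (s : B)

theorem mul_heckeGen_of_mem_projIndec {x : A} (hx : x ∈ cs.projIndec k s) {i : B}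
    (hi : cs.simple i ≠ cs.simple s) : x * ι (M.heckeGen i) = x := by
  obtain ⟨a, rfl⟩ := Submodule.mem_span_singleton.mp hx
  rw [smul_eq_mul, mul_assoc, sub_mul, ← map_mul, ← map_mul, heckeZero_mul,
    heckeIdem_mul_heckeGen _ hi]

theorem heckeZero_mul_of_mem_projIndec {x : A} (hx : x ∈ cs.projIndec k s) :
    ι cs.heckeZero * x = 0 := by
  obtain ⟨a, rfl⟩ := Submodule.mem_span_singleton.mp hx
  rw [smul_eq_mul]
  induction a using MonoidAlgebra.induction_on with
  | of h =>
    rw [← mul_assoc, ← map_mul, mul_sub, ← map_mul, ← map_mul, heckeZero_mul, heckeZero_mul,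
      heckeZero_mul, sub_self]
  | add y z hy hz =>
    rw [add_mul, mul_add, hy (Submodule.smul_mem _ _ (Submodule.mem_span_singleton_self _)),
      hz (Submodule.smul_mem _ _ (Submodule.mem_span_singleton_self _)), add_zero]
  | smul r y hy =>
    rw [smul_mul_assoc, mul_smul_comm,
      hy (Submodule.smul_mem _ _ (Submodule.mem_span_singleton_self _)), smul_zero]

/-- The generator `z_{w_0 s} - e_0` of the socle of `P'_{(s)}`. -/
noncomputable def socleGenerator : A :=
  ι (cs.heckeElt (cs.longest * cs.simple s)) - ι cs.heckeZero

theorem coeff_socleGenerator : (cs.socleGenerator k s).coeff cs.heckeZero = -1 := by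
  classical
  have hne : cs.heckeElt (cs.longest * cs.simple s) ≠ cs.heckeZero := by
    intro h
    have := cs.heckeElt_injective h
    rw [mul_eq_left] at this
    have h1 := cs.length_simple s
    rw [this, length_one] at h1
    exact zero_ne_one h1
  simp [socleGenerator, hne]

theorem socleGenerator_ne_zero : cs.socleGenerator k s ≠ 0 := by
  intro h
  have := cs.coeff_socleGenerator k s
  rw [h] at this
  simp at this

theorem heckeGen_mul_socleGenerator_of_ne {i : B}
    (hi : cs.simple i ≠ cs.longest * cs.simple s * cs.longest) :
    ι (M.heckeGen i) * cs.socleGenerator k s = cs.socleGenerator k s := by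
  have hd : cs.IsLeftDescent (cs.longest * cs.simple s) i := by
    by_contra hd
    rw [not_isLeftDescent_iff] at hd
    have h1 := cs.length_longest_mul (cs.simple s)
    rw [length_simple] at h1
    -- Since ℓ(w_0 s) = ℓ(w_0) - 1, a longer s_i w_0 s has maximal length, hence equals w_0,
    -- contrary to `hi`.
    have h2 := cs.length_longest_mul (cs.longest * (cs.simple i * (cs.longest * cs.simple s)))
    rw [longest_mul_longest_mul] at h2
    have h3 := cs.length_eq_zero_iff.mp
      (show cs.length (cs.longest * (cs.simple i * (cs.longest * cs.simple s))) = 0 by omega)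
    apply hi
    have h4 : cs.simple i * (cs.longest * cs.simple s) = cs.longest := by
      rw [← cs.longest_mul_longest_mul (cs.simple i * _), h3, mul_one]
    rw [eq_mul_inv_of_mul_eq h4, mul_inv_rev, longest_inv, inv_simple, mul_assoc]
  rw [socleGenerator, mul_sub, ← map_mul, ← map_mul, mul_heckeZero,
    heckeGen_mul_heckeElt_of_isLeftDescent _ hd]

theorem heckeGen_mul_socleGenerator_of_eq {i : B}
    (hi : cs.simple i = cs.longest * cs.simple s * cs.longest) :
    ι (M.heckeGen i) * cs.socleGenerator k s = 0 := by
  have h : cs.longest * cs.simple s = cs.simple i * cs.longest := by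
    rw [hi, mul_assoc, longest_mul_longest, mul_one]
  rw [socleGenerator, mul_sub, ← map_mul, ← map_mul, mul_heckeZero,
    (cs.heckeGen_mul_heckeElt_eq_heckeZero_iff i _).mpr (Or.inr h), sub_self]

/-- Every s_i ≠ s is a right descent of w_0 s, so z_{w_0 s} absorbs e_{(s)} and z_{w_0 s}(e_{(s)} -
e_0) is the generator. -/
theorem socleGenerator_mem_projIndec : cs.socleGenerator k s ∈ cs.projIndec k s := by
  refine Submodule.mem_span_singleton.mpr ⟨ι (cs.heckeElt (cs.longest * cs.simple s)), ?_⟩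
  rw [smul_eq_mul, mul_sub, ← map_mul, ← map_mul, mul_heckeZero, mul_heckeIdem, socleGenerator]
  intro i hi
  apply cs.heckeElt_mul_heckeGen_of_isRightDescent
  by_contra hd
  rw [not_isRightDescent_iff, mul_assoc] at hd
  have h1 := cs.length_longest_mul (cs.simple s)
  have h2 := cs.length_longest_mul (cs.simple s * cs.simple i)
  rw [length_simple] at h1
  have h3 := cs.length_eq_zero_iff.mp
    (show cs.length (cs.simple s * cs.simple i) = 0 by omega)
  exact hi (by rw [← inv_eq_of_mul_eq_one_right h3, inv_simple])

theorem mul_socleGenerator (a : A) :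
    a * cs.socleGenerator k s = MonoidAlgebra.lift k k M.ZeroHecke
      (M.character k (cs.maximalSubset (cs.longest * cs.simple s * cs.longest))) a
        • cs.socleGenerator k s :=
  mul_eq_lift_character_smul k (fun _ hi => cs.heckeGen_mul_socleGenerator_of_ne k s hi)
    (fun _ hi => cs.heckeGen_mul_socleGenerator_of_eq k s (not_not.mp hi)) a

theorem socleGenerator_mem {N : Submodule A A} (hN : N ≠ ⊥) (hP : N ≤ cs.projIndec k s) :
    cs.socleGenerator k s ∈ N := by
  obtain ⟨x, hxN, hx0, hx⟩ := cs.exists_mem_heckeGen_mul k hN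
  have hxP := hP hxN
  have hμ := cs.coeff_heckeZero_ne_zero k hx0 hx
  have h1 : ∀ i, cs.simple i ≠ cs.longest * cs.simple s * cs.longest →
      ι (M.heckeGen i) * x = x := by
    intro i hi
    refine (hx i).resolve_right fun h0 => hμ ?_
    obtain ⟨j, hj⟩ := cs.exists_simple_eq_longest_conj i
    have hjs : cs.simple j ≠ cs.simple s := by
      intro h
      apply hi
      rw [← h, hj]
      simp [mul_assoc, longest_mul_longest, longest_mul_longest_mul]
    have h2 := cs.coeff_heckeGen_mul k hj x
    rw [h0, cs.mul_heckeGen_of_mem_projIndec k s hxP hjs] at h2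
    simpa using h2.symm
  have h0 : ∀ i, cs.simple i = cs.longest * cs.simple s * cs.longest →
      ι (M.heckeGen i) * x = 0 := by
    intro i hi
    refine (hx i).resolve_left fun h => hx0 ?_
    have hall : ∀ j, ι (M.heckeGen j) * x = x := by
      intro j
      by_cases hj : cs.simple j = cs.longest * cs.simple s * cs.longest
      -- Distinct indices give distinct simple reflections, since otherwise `M i j` would divide 1.
      · have hij : i = j := by
          by_contra hij
          have hp : (cs.simple i * cs.simple j) ^ 1 = 1 := by
            rw [pow_one, hi, ← hj, simple_mul_simple_self]
          exact M.off_diagonal i j hij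
            (Nat.dvd_one.mp (cs.dvd_of_simple_mul_simple_pow_eq_one hij 1 hp))
        rwa [← hij]
      · exact h1 j hj
    have hfix : ι cs.heckeZero * x = x :=
      zeroHecke_induction (p := fun h => ι h * x = x) cs.heckeZero
        (by rw [map_one, one_mul]) fun j y hy => by rw [map_mul, mul_assoc, hy, hall]
    rw [← hfix, cs.heckeZero_mul_of_mem_projIndec k s hxP]
  -- The generator has coefficient -1 at `e_0`, so this joint eigenvector has coefficient 0 there
  -- and must vanish.
  have hzero : x + x.coeff cs.heckeZero • cs.socleGenerator k s = 0 := by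
    by_contra hne
    refine cs.coeff_heckeZero_ne_zero k hne (fun i => ?_) ?_
    · by_cases hi : cs.simple i = cs.longest * cs.simple s * cs.longest
      · right
        rw [mul_add, mul_smul_comm, h0 i hi, cs.heckeGen_mul_socleGenerator_of_eq k s hi, smul_zero,
          add_zero]
      · left
        rw [mul_add, mul_smul_comm, h1 i hi, cs.heckeGen_mul_socleGenerator_of_ne k s hi]
    · simp [coeff_socleGenerator]
  have hv : cs.socleGenerator k s = (-(x.coeff cs.heckeZero)⁻¹) • x := by
    rw [eq_neg_of_add_eq_zero_left hzero, smul_neg, neg_smul, neg_neg, smul_smul]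
    simp [coeff_socleGenerator, hμ]
  rw [hv]
  exact N.smul_of_tower_mem _ hxN

end CoxeterSystem

/-! ### The socle of P'_{(s)} and its character -/

namespace CoxeterSystem

variable {B W : Type*} [Group W] {M : CoxeterMatrix B} (cs : CoxeterSystem M W)
  (k : Type*) [Field k] [Finite W] (s : B)

/-- The generator `z_{w_0 s} - e_0` of the socle, as an element of `P'_{(s)}`. -/
noncomputable def socleVector : cs.projIndec k s :=
  ⟨cs.socleGenerator k s, cs.socleGenerator_mem_projIndec k s⟩

theorem socleVector_ne_zero : cs.socleVector k s ≠ 0 :=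
  fun h => cs.socleGenerator_ne_zero k s (congrArg Subtype.val h)

theorem socleVector_mem {N : Submodule (MonoidAlgebra k M.ZeroHecke) (cs.projIndec k s)}
    (hN : N ≠ ⊥) : cs.socleVector k s ∈ N := by
  have h := cs.socleGenerator_mem k s (N := N.map (cs.projIndec k s).subtype)
    (fun h => hN (Submodule.map_injective_of_injective (Submodule.subtype_injective _)
      (h.trans (Submodule.map_bot _).symm)))
    (Submodule.map_subtype_le _ _)
  obtain ⟨x, hx, he⟩ := Submodule.mem_map.mp h
  have : x = cs.socleVector k s := Subtype.ext he
  rwa [← this]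

theorem isAtom_span_socleVector :
    IsAtom (Submodule.span (MonoidAlgebra k M.ZeroHecke) {cs.socleVector k s}) := by
  refine ⟨by simpa using cs.socleVector_ne_zero k s, fun N hN => ?_⟩
  by_contra hne
  exact hN.not_ge ((Submodule.span_singleton_le_iff_mem _ _).mpr (cs.socleVector_mem k s hne))

theorem moduleSocle_projIndec :
    moduleSocle (MonoidAlgebra k M.ZeroHecke) (cs.projIndec k s)
      = Submodule.span (MonoidAlgebra k M.ZeroHecke) {cs.socleVector k s} := by
  have hatom := cs.isAtom_span_socleVector k s
  apply le_antisymm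
  · refine sSup_le fun N hN => ?_
    have hN : IsAtom N := isSimpleModule_iff_isAtom.mp hN
    have hle := (Submodule.span_singleton_le_iff_mem _ _).mpr (cs.socleVector_mem k s hN.1)
    rcases hN.le_iff.mp hle with h | h
    · exact absurd h hatom.1
    · exact h.ge
  · exact le_sSup (isSimpleModule_iff_isAtom.mpr hatom)

/-- Two nonzero submodules share the socle vector, so they cannot be complementary. -/
theorem moduleIndecomposable_projIndec :
    ModuleIndecomposable (MonoidAlgebra k M.ZeroHecke) (cs.projIndec k s) := by
  refine ⟨⟨_, _, cs.socleVector_ne_zero k s⟩, fun N N' h => ?_⟩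
  by_contra! hne
  exact cs.socleVector_ne_zero k s (Submodule.disjoint_def.mp h.disjoint _
    (cs.socleVector_mem k s hne.1) (cs.socleVector_mem k s hne.2))

theorem restrictScalars_span_socleGenerator :
    (Submodule.span (MonoidAlgebra k M.ZeroHecke) {cs.socleGenerator k s}).restrictScalars k
      = Submodule.span k {cs.socleGenerator k s} := by
  apply le_antisymm
  · intro x hx
    obtain ⟨a, rfl⟩ := Submodule.mem_span_singleton.mp
      ((Submodule.restrictScalars_mem _ _ _).mp hx)
    rw [smul_eq_mul, mul_socleGenerator]
    exact Submodule.smul_mem _ _ (Submodule.mem_span_singleton_self _)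
  · rw [Submodule.span_singleton_le_iff_mem]
    exact Submodule.mem_span_singleton_self _

/-- The embedding of `θ_{(w_0 s w_0)}` into `P'_{(s)}`. -/
noncomputable def thetaEmbedding :
    (M.theta k (cs.maximalSubset (cs.longest * cs.simple s * cs.longest))).asModule
      →ₗ[MonoidAlgebra k M.ZeroHecke] cs.projIndec k s where
  toFun c := (M.theta k (cs.maximalSubset
    (cs.longest * cs.simple s * cs.longest))).asModuleEquiv c • cs.socleVector k s
  map_add' c d := by rw [map_add, add_smul]
  map_smul' a c := by
    rw [Representation.asModuleEquiv_map_smul, M.theta_asAlgebraHom_apply, RingHom.id_apply]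
    apply Subtype.ext
    change _ • cs.socleGenerator k s = a * (_ • cs.socleGenerator k s)
    rw [mul_smul_comm, mul_socleGenerator, smul_smul, mul_comm]

theorem thetaEmbedding_injective : Function.Injective (cs.thetaEmbedding k s) := by
  rw [injective_iff_map_eq_zero]
  intro c hc
  have := (smul_eq_zero.mp hc).resolve_right (cs.socleVector_ne_zero k s)
  simpa using this

theorem range_thetaEmbedding : LinearMap.range (cs.thetaEmbedding k s)
    = moduleSocle (MonoidAlgebra k M.ZeroHecke) (cs.projIndec k s) := by
  rw [moduleSocle_projIndec]
  apply le_antisymm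
  · rintro _ ⟨c, rfl⟩
    exact Submodule.smul_of_tower_mem _ _ (Submodule.mem_span_singleton_self _)
  · rw [Submodule.span_singleton_le_iff_mem]
    refine ⟨(M.theta k (cs.maximalSubset
      (cs.longest * cs.simple s * cs.longest))).asModuleEquiv.symm 1, ?_⟩
    change (M.theta k _).asModuleEquiv _ • cs.socleVector k s = _
    rw [LinearEquiv.apply_symm_apply, one_smul]

end CoxeterSystem

theorem mainTheorem6 {B W : Type*} [Group W] [Finite W] {M : CoxeterMatrix B}
    (cs : CoxeterSystem M W) (k : Type*) [Field k] (s : B) :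
    -- `P'_{(s)}` is a projective indecomposable module
    Module.Projective (MonoidAlgebra k M.ZeroHecke) (cs.projIndec k s) ∧
    ModuleIndecomposable (MonoidAlgebra k M.ZeroHecke) (cs.projIndec k s) ∧
    -- its socle is simple
    IsSimpleModule (MonoidAlgebra k M.ZeroHecke)
      (moduleSocle (MonoidAlgebra k M.ZeroHecke) (cs.projIndec k s)) ∧
    -- its socle, as a subspace of the monoid algebra, is the line spanned by `z_{w_0 s} - e_0`
    ((moduleSocle (MonoidAlgebra k M.ZeroHecke) (cs.projIndec k s)).map
        (cs.projIndec k s).subtype).restrictScalars k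
      = Submodule.span k
          {MonoidAlgebra.of k M.ZeroHecke (cs.heckeElt (cs.longest * cs.simple s))
            - MonoidAlgebra.of k M.ZeroHecke cs.heckeZero} ∧
    -- its socle is isomorphic to `θ_{(w_0 s w_0)}`
    Nonempty (moduleSocle (MonoidAlgebra k M.ZeroHecke) (cs.projIndec k s)
      ≃ₗ[MonoidAlgebra k M.ZeroHecke]
        (M.theta k (cs.maximalSubset (cs.longest * cs.simple s * cs.longest))).asModule) ∧
    -- where `θ_J (z_w)` is the identity if `w ∈ W_J` and zero otherwise
    (∀ (J : Set B) (w : W),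
      (w ∈ cs.parabolic J → M.theta k J (cs.heckeElt w) = 1) ∧
      (w ∉ cs.parabolic J → M.theta k J (cs.heckeElt w) = 0)) := by
  refine ⟨(cs.isIdempotentElem_heckeIdem_sub k _).projective_span_singleton,
    cs.moduleIndecomposable_projIndec k s, ?_, ?_,
    ⟨((LinearEquiv.ofInjective _ (cs.thetaEmbedding_injective k s)).trans
      (LinearEquiv.ofEq _ _ (cs.range_thetaEmbedding k s))).symm⟩, fun J w => ⟨fun hw => ?_,
      fun hw => ?_⟩⟩
  · rw [cs.moduleSocle_projIndec k s]
    exact isSimpleModule_iff_isAtom.mpr (cs.isAtom_span_socleVector k s)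
  · rw [cs.moduleSocle_projIndec k s, Submodule.map_span, Set.image_singleton]
    exact cs.restrictScalars_span_socleGenerator k s
  · ext
    rw [M.theta_apply, cs.character_heckeElt, if_pos hw]
    simp
  · ext
    rw [M.theta_apply, cs.character_heckeElt, if_neg hw]
    simp
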